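/- For $n\ge 1$ let $\Omega_n\cong\mathbb C^{6n}$ be the space of polynomial mappings $\mathbb C^2\to\mathbb C^n$ all of whose components have degree at most $2$, with the standard topology on the coefficients. For $F\in\Omega_n$ let $O(F)=\{L\circ F\circ R\}$, where $L$ and $R$ run over the invertible affine transformations of $\mathbb C^n$ and of $\mathbb C^2$. Consider the following $34$ mappings. In $\Omega_5$: $G_0=(x^2,xy,y^2,x,y)$. In $\Omega_4$: $G_1=(x^2+y,y^2,xy,x)$, $G_2=(x^2,y^2,xy,x)$, $G_3=(x^2,y^2,x,y)$, $G_4=(x^2,xy,x,y)$. In $\Omega_3$: $F_1=(x^2+y,y^2+x,xy)$, $F_2=(x^2+y,y^2+x,xy+\frac12x+\frac12y)$, $F_3=(x^2,y^2+x,xy)$, $F_4=(x^2,y^2,xy)$, $F_5=(x^2,y^2,x+y)$, $F_6=(x^2+y,y^2,x)$, $F_7=(x^2+y,y^2+x,0)$, $F_8=(x^2,xy,y)$, $F_9=(x^2+y,xy,x)$, $F_{10}=(x^2+y,xy,0)$, $F_{11}=(x^2,y^2,y)$, $F_{12}=(x^2+y,y^2,0)$, $F_{13}=(x^2,y^2,0)$,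 $F_{14}=(x^2,xy,x)$, $F_{15}=(x^2-x,xy,0)$, $F_{16}=(x^2,xy,0)$, $F_{17}=(xy,x,y)$, $F_{18}=(x^2,x,y)$, $F_{19}=(xy,x+y,0)$, $F_{20}=(x,xy,0)$, $F_{21}=(x^2,y,0)$, $F_{22}=(x^2+y,x,0)$, $F_{23}=(x^2,x,0)$, $F_{24}=(x,y,0)$, $F_{25}=(xy,0,0)$, $F_{26}=(x^2+y,0,0)$, $F_{27}=(x^2,0,0)$, $F_{28}=(x,0,0)$, $F_{29}=(0,0,0)$. Let $n\ge3$. Each of these mappings whose target $\mathbb C^m$ has $m\le n$ is regarded as an element of $\Omega_n$ by composing it with the standard inclusion $\mathbb C^m\to\mathbb C^n$. Then every element of $\Omega_n$ lies in the orbit of exactly one of these mappings. Moreover, for two of these mappings $A$ and $B$ (with targets of dimension at most $n$), $O(A)\subset\overline{O(B)}$ if and only if $A=B$ or $A$ can be reached from $B$ by going down along edges of the following diagram, in which $P\to Q_1,Q_2,\dots$ means that there are edges from $P$ down to $Q_1,Q_2,\dots$: $G_0\to G_1$; $G_1\to G_2$; $G_2\to G_3,F_1$; $G_3\to G_4,F_5$;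 $G_4\to F_8$; $F_1\to F_2,F_5$; $F_2\to F_3,F_6,F_8$; $F_3\to F_4,F_7,F_9,F_{14}$; $F_4\to F_{13},F_{18},F_{25}$; $F_5\to F_6,F_8$; $F_6\to F_7,F_9,F_{11}$; $F_7\to F_{10},F_{12}$; $F_8\to F_9$; $F_9\to F_{10},F_{14},F_{17}$; $F_{10}\to F_{15},F_{19}$; $F_{11}\to F_{12},F_{14}$; $F_{12}\to F_{13},F_{15},F_{19}$; $F_{13}\to F_{16},F_{21}$; $F_{14}\to F_{15},F_{18}$; $F_{15}\to F_{16},F_{20},F_{21}$; $F_{16}\to F_{22},F_{23},F_{25}$; $F_{17}\to F_{18},F_{19}$; $F_{18}\to F_{21},F_{23}$; $F_{19}\to F_{20},F_{21}$; $F_{20}\to F_{22},F_{23},F_{25}$; $F_{21}\to F_{22}$; $F_{22}\to F_{23},F_{24},F_{26}$; $F_{23}\to F_{27}$; $F_{24}\to F_{28}$; $F_{25}\to F_{26}$; $F_{26}\to F_{27}$; $F_{27}\to F_{28}$; $F_{28}\to F_{29}$. In particular $O(G_3)\subset\overline{O(G_2)}$ (for $n\ge4$), $O(F_{11})\not\subset\overline{O(F_3)}$,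 $O(F_{17})\not\subset\overline{O(F_{11})}$ and $O(F_{20})\not\subset\overline{O(F_4)}$. -/

import Mathlib

/-! Quadratic mappings `ℂ² → ℂⁿ`, their orbits under affine changes of coordinates in the source
and in the target, the list of normal forms, and the adjacency diagram of the orbits. -/

namespace QuadOrbits

/-- A polynomial of degree at most two in two variables, as the vector `(a, b, c, d, e, g)` of the
coefficients of `a x² + b xy + c y² + d x + e y + g`. -/
abbrev QuadPoly : Type := Fin 6 → ℂ

/-- The value of a quadratic polynomial at a point `p = (x, y)` of `ℂ²`. -/
def QuadPoly.eval (f : QuadPoly) (p : Fin 2 → ℂ) : ℂ :=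
  f 0 * p 0 ^ 2 + f 1 * (p 0 * p 1) + f 2 * p 1 ^ 2 + f 3 * p 0 + f 4 * p 1 + f 5

/-- The space of polynomial mappings `ℂ² → ℂⁿ` with components of degree at most two. It is the
space `ℂ^(6n)` of coefficients, and carries the usual topology of that space. -/
abbrev QuadMap (n : ℕ) : Type := Fin n → QuadPoly

/-- The mapping `ℂ² → ℂⁿ` given by a tuple of quadratic polynomials. -/
def QuadMap.eval {n : ℕ} (F : QuadMap n) (p : Fin 2 → ℂ) : Fin n → ℂ :=
  fun i => QuadPoly.eval (F i) p

/-- The orbit `O(G)` of all `L ∘ G ∘ R` with `L` and `R` invertible affine transformations of `ℂⁿ`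
and of `ℂ²`. -/
def orbit {n : ℕ} (G : QuadMap n) : Set (QuadMap n) :=
  {F | ∃ (L : (Fin n → ℂ) ≃ᵃ[ℂ] (Fin n → ℂ)) (R : (Fin 2 → ℂ) ≃ᵃ[ℂ] (Fin 2 → ℂ)),
    ∀ p, QuadMap.eval F p = L (QuadMap.eval G (R p))}

/-- The composition of `F : ℂ² → ℂᵐ` with the standard inclusion `ℂᵐ → ℂⁿ` (used for `m ≤ n`). -/
def extend {m : ℕ} (F : QuadMap m) (n : ℕ) : QuadMap n :=
  fun i => if h : (i : ℕ) < m then F ⟨i, h⟩ else 0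

/-- The monomial `x²`. -/
def mxx : QuadPoly := ![1, 0, 0, 0, 0, 0]
/-- The monomial `xy`. -/
def mxy : QuadPoly := ![0, 1, 0, 0, 0, 0]
/-- The monomial `y²`. -/
def myy : QuadPoly := ![0, 0, 1, 0, 0, 0]
/-- The monomial `x`. -/
def mx : QuadPoly := ![0, 0, 0, 1, 0, 0]
/-- The monomial `y`. -/
def my : QuadPoly := ![0, 0, 0, 0, 1, 0]

/-- The names of the normal forms. -/
inductive Label : Type
  | G0 | G1 | G2 | G3 | G4
  | F1 | F2 | F3 | F4 | F5 | F6 | F7 | F8 | F9 | F10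
  | F11 | F12 | F13 | F14 | F15 | F16 | F17 | F18 | F19 | F20
  | F21 | F22 | F23 | F24 | F25 | F26 | F27 | F28 | F29
  deriving DecidableEq

/-- The dimension of the target space in which a normal form is written. -/
def Label.dim : Label → ℕ
  | .G0 => 5
  | .G1 | .G2 | .G3 | .G4 => 4
  | _ => 3

/-- The normal forms. -/
noncomputable def Label.rep : (a : Label) → QuadMap a.dim
  | .G0 => ![mxx, mxy, myy, mx, my]
  | .G1 => ![mxx + my, myy, mxy, mx]
  | .G2 => ![mxx, myy, mxy, mx]
  | .G3 => ![mxx, myy, mx, my]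
  | .G4 => ![mxx, mxy, mx, my]
  | .F1 => ![mxx + my, myy + mx, mxy]
  | .F2 => ![mxx + my, myy + mx, mxy + (1 / 2 : ℂ) • mx + (1 / 2 : ℂ) • my]
  | .F3 => ![mxx, myy + mx, mxy]
  | .F4 => ![mxx, myy, mxy]
  | .F5 => ![mxx, myy, mx + my]
  | .F6 => ![mxx + my, myy, mx]
  | .F7 => ![mxx + my, myy + mx, 0]
  | .F8 => ![mxx, mxy, my]
  | .F9 => ![mxx + my, mxy, mx]
  | .F10 => ![mxx + my, mxy, 0]
  | .F11 => ![mxx, myy, my]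
  | .F12 => ![mxx + my, myy, 0]
  | .F13 => ![mxx, myy, 0]
  | .F14 => ![mxx, mxy, mx]
  | .F15 => ![mxx - mx, mxy, 0]
  | .F16 => ![mxx, mxy, 0]
  | .F17 => ![mxy, mx, my]
  | .F18 => ![mxx, mx, my]
  | .F19 => ![mxy, mx + my, 0]
  | .F20 => ![mx, mxy, 0]
  | .F21 => ![mxx, my, 0]
  | .F22 => ![mxx + my, mx, 0]
  | .F23 => ![mxx, mx, 0]
  | .F24 => ![mx, my, 0]
  | .F25 => ![mxy, 0, 0]
  | .F26 => ![mxx + my, 0, 0]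
  | .F27 => ![mxx, 0, 0]
  | .F28 => ![mx, 0, 0]
  | .F29 => ![0, 0, 0]

/-- The orbit, in the space of quadratic mappings `ℂ² → ℂⁿ`, of the normal form `a` composed with
the standard inclusion into `ℂⁿ`. -/
noncomputable def Label.orbit (n : ℕ) (a : Label) : Set (QuadMap n) :=
  QuadOrbits.orbit (extend a.rep n)

open Label in
/-- The edges of the diagram: each normal form with the neighbours drawn below it. -/
def below : Label → List Label
  | G0 => [G1]
  | G1 => [G2]
  | G2 => [G3, F1]
  | G3 => [G4, F5]
  | G4 => [F8]
  | F1 => [F2, F5]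
  | F2 => [F3, F6, F8]
  | F3 => [F4, F7, F9, F14]
  | F4 => [F13, F18, F25]
  | F5 => [F6, F8]
  | F6 => [F7, F9, F11]
  | F7 => [F10, F12]
  | F8 => [F9]
  | F9 => [F10, F14, F17]
  | F10 => [F15, F19]
  | F11 => [F12, F14]
  | F12 => [F13, F15, F19]
  | F13 => [F16, F21]
  | F14 => [F15, F18]
  | F15 => [F16, F20, F21]
  | F16 => [F22, F23, F25]
  | F17 => [F18, F19]
  | F18 => [F21, F23]
  | F19 => [F20, F21]
  | F20 => [F22, F23, F25]
  | F21 => [F22]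
  | F22 => [F23, F24, F26]
  | F23 => [F27]
  | F24 => [F28]
  | F25 => [F26]
  | F26 => [F27]
  | F27 => [F28]
  | F28 => [F29]
  | F29 => []

/-- A (possibly trivial) rising path of the diagram leads from `a` up to `b`. -/
def RisingPath (a b : Label) : Prop :=
  Relation.ReflTransGen (fun lower upper => lower ∈ below upper) a b

end QuadOrbits

/-! Translations in the target remove constant terms, so a mapping matters only through the tuple of
its components in the five-dimensional space `Cls` of quadratic polynomials modulo constants. Two
tuples of equal length with the same span differ by an invertible matrix, so an orbit is the same as
a subspace of `Cls` of dimension at most `n`, up to affine substitutions of the plane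
(`mem_orbit_iff_span`).

Existence of a normal form is a classification of these subspaces (`classified`). The space of
quadratic parts is first brought to one of six shapes (`topClassified`). If it is not everything,
completing squares finishes. If it is everything and no linear form is present, the subspace is the
graph of a linear map from quadratic to linear forms. The crucial step finds in it an element `ℓ² +
ρℓ` with `ℓ` a nonzero linear form, which amounts to a root of a binary cubic
(`exists_square_add_mem`).

For closures, invertible matrices are dense among all matrices. Hence containment of an orbit in the
closure of another means that the first normal form is a limit of tuples of arbitrary combinations
of the second after substitutions. This relation, `Degen`, is a preorder independent of `n`
(`orbit_subset_closure_iff`). Each edge of the diagram is witnessed by linear combinations or by an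
explicit curve (`degen_of_mem_below`).

Each missing relation follows from one of 24 basic ones: if `a` is not below `b`, some basic pair
`(p, q)` has `p` below `a` and `b` below `q`, so a degeneration of `b` to `a` would compose to one
of `q` to `p` (`degen_gens_iff`). The 24 are excluded by closed conditions which hold for everything
derived from `q` and fail for `p`: vanishing minors, conditions on a covariant binary cubic, and
existence of a special direction or critical point, which is closed by compactness of projective
space.

Uniqueness of the normal form follows, since two normal forms of the same mapping degenerate to each
other and the diagram has no cycles. -/

namespace QuadOrbits

open Set Filter Topology

/-! ### Quadratic polynomials modulo constants and the action of affine substitutions. -/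

/-- Quadratic polynomials modulo constants: the coefficients of `x², xy, y², x, y`. -/
abbrev Cls : Type := Fin 5 → ℂ

/-- The class of a quadratic polynomial modulo constants. -/
def cls : QuadPoly →ₗ[ℂ] Cls where
  toFun f := ![f 0, f 1, f 2, f 3, f 4]
  map_add' f g := by ext i; fin_cases i <;> simp
  map_smul' c f := by ext i; fin_cases i <;> simp

/-- An invertible affine substitution `(x, y) ↦ (a x + b y + c, d x + e y + g)`. -/
@[ext] structure Chart where
  (a b c d e g : ℂ)
  det_ne : a * e - b * d ≠ 0

namespace Chart

/-- Substitution into a quadratic polynomial, modulo constants. -/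
def pull (R : Chart) : Cls →ₗ[ℂ] Cls where
  toFun f := ![f 0 * R.a ^ 2 + f 1 * (R.a * R.d) + f 2 * R.d ^ 2,
    2 * f 0 * (R.a * R.b) + f 1 * (R.a * R.e + R.b * R.d) + 2 * f 2 * (R.d * R.e),
    f 0 * R.b ^ 2 + f 1 * (R.b * R.e) + f 2 * R.e ^ 2,
    2 * f 0 * (R.a * R.c) + f 1 * (R.a * R.g + R.c * R.d) + 2 * f 2 * (R.d * R.g)
      + f 3 * R.a + f 4 * R.d,
    2 * f 0 * (R.b * R.c) + f 1 * (R.b * R.g + R.c * R.e) + 2 * f 2 * (R.e * R.g)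
      + f 3 * R.b + f 4 * R.e]
  map_add' f g := by ext i; fin_cases i <;> simp <;> ring
  map_smul' c f := by ext i; fin_cases i <;> simp <;> ring

theorem pull_vec (R : Chart) (p q r u v : ℂ) :
    R.pull ![p, q, r, u, v] = ![p * R.a ^ 2 + q * (R.a * R.d) + r * R.d ^ 2,
    2 * p * (R.a * R.b) + q * (R.a * R.e + R.b * R.d) + 2 * r * (R.d * R.e),
    p * R.b ^ 2 + q * (R.b * R.e) + r * R.e ^ 2,
    2 * p * (R.a * R.c) + q * (R.a * R.g + R.c * R.d) + 2 * r * (R.d * R.g)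
      + u * R.a + v * R.d,
    2 * p * (R.b * R.c) + q * (R.b * R.g + R.c * R.e) + 2 * r * (R.e * R.g)
      + u * R.b + v * R.e] := rfl

/-- Composition of substitutions: first `S`, then `R`. -/
def comp (R S : Chart) : Chart where
  a := R.a * S.a + R.b * S.d
  b := R.a * S.b + R.b * S.e
  c := R.a * S.c + R.b * S.g + R.c
  d := R.d * S.a + R.e * S.d
  e := R.d * S.b + R.e * S.e
  g := R.d * S.c + R.e * S.g + R.g
  det_ne := by
    have := mul_ne_zero R.det_ne S.det_ne
    convert this using 1; ring

theorem pull_comp (R S : Chart) (f : Cls) : (R.comp S).pull f = S.pull (R.pull f) := by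
  ext i; fin_cases i <;> simp [pull, comp] <;> ring

/-- The inverse substitution. -/
noncomputable def inv (R : Chart) : Chart where
  a := R.e * (R.a * R.e - R.b * R.d)⁻¹
  b := -R.b * (R.a * R.e - R.b * R.d)⁻¹
  c := (R.b * R.g - R.e * R.c) * (R.a * R.e - R.b * R.d)⁻¹
  d := -R.d * (R.a * R.e - R.b * R.d)⁻¹
  e := R.a * (R.a * R.e - R.b * R.d)⁻¹
  g := (R.d * R.c - R.a * R.g) * (R.a * R.e - R.b * R.d)⁻¹
  det_ne := by
    have h := mul_inv_cancel₀ R.det_ne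
    intro h0
    have : (R.a * R.e - R.b * R.d)⁻¹ = 0 := by
      linear_combination h0 - (R.a * R.e - R.b * R.d)⁻¹ * h
    exact inv_ne_zero R.det_ne this

/-- The identity substitution. -/
def one : Chart := ⟨1, 0, 0, 0, 1, 0, by norm_num⟩

theorem pull_one (f : Cls) : one.pull f = f := by
  ext i; fin_cases i <;> simp [pull, one]

theorem comp_inv (R : Chart) : R.comp R.inv = one := by
  have h := mul_inv_cancel₀ R.det_ne
  ext <;> simp only [comp, inv, one]
  · linear_combination h
  · ring
  · linear_combination -R.c * h
  · ring
  · linear_combination h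
  · linear_combination -R.g * h

theorem inv_comp (R : Chart) : R.inv.comp R = one := by
  have h := mul_inv_cancel₀ R.det_ne
  ext <;> simp only [comp, inv, one]
  · linear_combination h
  · ring
  · ring
  · ring
  · linear_combination h
  · ring

theorem inv_pull_pull (R : Chart) (f : Cls) : R.inv.pull (R.pull f) = f := by
  rw [← pull_comp, comp_inv, pull_one]

theorem pull_inv_pull (R : Chart) (f : Cls) : R.pull (R.inv.pull f) = f := by
  rw [← pull_comp, inv_comp, pull_one]

theorem continuous_pull (R : Chart) : Continuous R.pull :=
  LinearMap.continuous_of_finiteDimensional _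

end Chart

/-! ### The degeneration preorder. -/

/-- The tuples of combinations of the members of `u` after a common substitution. -/
def shadow {k : ℕ} (m : ℕ) (u : Fin k → Cls) : Set (Fin m → Cls) :=
  {f | ∃ (R : Chart) (A : Fin m → Fin k → ℂ), ∀ i, f i = ∑ j, A i j • R.pull (u j)}

/-- The tuple `v` is a limit of tuples of combinations of `u` after substitutions. -/
def Degen {m k : ℕ} (v : Fin m → Cls) (u : Fin k → Cls) : Prop := v ∈ closure (shadow m u)

/-- For a fixed substitution and fixed coefficients, forming the combinations is a continuous
operation on tuples. It sends combinations of `u` to combinations of `u`, hence limits to limits.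
Transitivity of `Degen` comes from this. -/
theorem shadow_subset_closure {m k l : ℕ} {v : Fin m → Cls} {u : Fin k → Cls} (h : Degen v u) :
    shadow l v ⊆ closure (shadow l u) := by
  rintro f ⟨R, A, hf⟩
  let Φ : (Fin m → Cls) → (Fin l → Cls) := fun w i => ∑ j, A i j • R.pull (w j)
  have hΦ : Continuous Φ := by
    refine continuous_pi fun i => continuous_finsetSum _ fun j _ => ?_
    have hj : Continuous fun w : Fin m → Cls => R.pull (w j) :=
      R.continuous_pull.comp (continuous_apply j)
    exact hj.const_smul (A i j)
  have : f = Φ v := funext hf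
  rw [this]
  refine map_mem_closure hΦ h ?_
  rintro w ⟨S, B, hw⟩
  refine ⟨S.comp R, fun i j => ∑ s, A i s * B s j, fun i => ?_⟩
  simp only [Φ, hw, map_sum, map_smul, Chart.pull_comp, Finset.smul_sum, Finset.sum_smul, smul_smul]
  exact Finset.sum_comm

theorem mem_shadow_self {m : ℕ} (u : Fin m → Cls) : u ∈ shadow m u :=
  ⟨Chart.one, fun i j => if i = j then 1 else 0, fun i => by simp [Chart.pull_one]⟩

theorem Degen.refl {m : ℕ} (u : Fin m → Cls) : Degen u u := subset_closure (mem_shadow_self u)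

theorem Degen.trans {m k l : ℕ} {w : Fin l → Cls} {v : Fin m → Cls} {u : Fin k → Cls}
    (h : Degen w v) (h' : Degen v u) : Degen w u :=
  closure_minimal (shadow_subset_closure h') isClosed_closure h

/-- The substitution and the coefficients may blow up as `t → 0`; only the resulting tuple `P t` has
to extend continuously. -/
theorem Degen.of_curve {m k : ℕ} {v : Fin m → Cls} {u : Fin k → Cls} (P : ℂ → Fin m → Cls)
    (hP : Continuous P) (h0 : P 0 = v)
    (h : ∀ t, t ≠ 0 → ∃ (R : Chart) (A : Fin m → Fin k → ℂ),
      ∀ i, P t i = ∑ j, A i j • R.pull (u j)) :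
    Degen v u := by
  have : Tendsto P (𝓝[≠] 0) (𝓝 v) := by
    rw [← h0]; exact hP.continuousAt.tendsto.mono_left nhdsWithin_le_nhds
  refine mem_closure_of_tendsto this ?_
  filter_upwards [self_mem_nhdsWithin] with t ht
  exact h t ht

theorem Degen.of_comb {m k : ℕ} {v : Fin m → Cls} {u : Fin k → Cls} (R : Chart)
    (A : Fin m → Fin k → ℂ) (h : ∀ i, v i = ∑ j, A i j • R.pull (u j)) : Degen v u :=
  subset_closure ⟨R, A, h⟩

/-- The classes of the components of the normal forms. -/
noncomputable def Label.gens : (a : Label) → Fin a.dim → Cls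
  | .G0 => ![![1, 0, 0, 0, 0], ![0, 1, 0, 0, 0], ![0, 0, 1, 0, 0],
      ![0, 0, 0, 1, 0], ![0, 0, 0, 0, 1]]
  | .G1 => ![![1, 0, 0, 0, 1], ![0, 0, 1, 0, 0], ![0, 1, 0, 0, 0], ![0, 0, 0, 1, 0]]
  | .G2 => ![![1, 0, 0, 0, 0], ![0, 0, 1, 0, 0], ![0, 1, 0, 0, 0], ![0, 0, 0, 1, 0]]
  | .G3 => ![![1, 0, 0, 0, 0], ![0, 0, 1, 0, 0], ![0, 0, 0, 1, 0], ![0, 0, 0, 0, 1]]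
  | .G4 => ![![1, 0, 0, 0, 0], ![0, 1, 0, 0, 0], ![0, 0, 0, 1, 0], ![0, 0, 0, 0, 1]]
  | .F1 => ![![1, 0, 0, 0, 1], ![0, 0, 1, 1, 0], ![0, 1, 0, 0, 0]]
  | .F2 => ![![1, 0, 0, 0, 1], ![0, 0, 1, 1, 0], ![0, 1, 0, 1 / 2, 1 / 2]]
  | .F3 => ![![1, 0, 0, 0, 0], ![0, 0, 1, 1, 0], ![0, 1, 0, 0, 0]]
  | .F4 => ![![1, 0, 0, 0, 0], ![0, 0, 1, 0, 0], ![0, 1, 0, 0, 0]]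
  | .F5 => ![![1, 0, 0, 0, 0], ![0, 0, 1, 0, 0], ![0, 0, 0, 1, 1]]
  | .F6 => ![![1, 0, 0, 0, 1], ![0, 0, 1, 0, 0], ![0, 0, 0, 1, 0]]
  | .F7 => ![![1, 0, 0, 0, 1], ![0, 0, 1, 1, 0], ![0, 0, 0, 0, 0]]
  | .F8 => ![![1, 0, 0, 0, 0], ![0, 1, 0, 0, 0], ![0, 0, 0, 0, 1]]
  | .F9 => ![![1, 0, 0, 0, 1], ![0, 1, 0, 0, 0], ![0, 0, 0, 1, 0]]
  | .F10 => ![![1, 0, 0, 0, 1], ![0, 1, 0, 0, 0], ![0, 0, 0, 0, 0]]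
  | .F11 => ![![1, 0, 0, 0, 0], ![0, 0, 1, 0, 0], ![0, 0, 0, 0, 1]]
  | .F12 => ![![1, 0, 0, 0, 1], ![0, 0, 1, 0, 0], ![0, 0, 0, 0, 0]]
  | .F13 => ![![1, 0, 0, 0, 0], ![0, 0, 1, 0, 0], ![0, 0, 0, 0, 0]]
  | .F14 => ![![1, 0, 0, 0, 0], ![0, 1, 0, 0, 0], ![0, 0, 0, 1, 0]]
  | .F15 => ![![1, 0, 0, -1, 0], ![0, 1, 0, 0, 0], ![0, 0, 0, 0, 0]]
  | .F16 => ![![1, 0, 0, 0, 0], ![0, 1, 0, 0, 0], ![0, 0, 0, 0, 0]]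
  | .F17 => ![![0, 1, 0, 0, 0], ![0, 0, 0, 1, 0], ![0, 0, 0, 0, 1]]
  | .F18 => ![![1, 0, 0, 0, 0], ![0, 0, 0, 1, 0], ![0, 0, 0, 0, 1]]
  | .F19 => ![![0, 1, 0, 0, 0], ![0, 0, 0, 1, 1], ![0, 0, 0, 0, 0]]
  | .F20 => ![![0, 0, 0, 1, 0], ![0, 1, 0, 0, 0], ![0, 0, 0, 0, 0]]
  | .F21 => ![![1, 0, 0, 0, 0], ![0, 0, 0, 0, 1], ![0, 0, 0, 0, 0]]
  | .F22 => ![![1, 0, 0, 0, 1], ![0, 0, 0, 1, 0], ![0, 0, 0, 0, 0]]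
  | .F23 => ![![1, 0, 0, 0, 0], ![0, 0, 0, 1, 0], ![0, 0, 0, 0, 0]]
  | .F24 => ![![0, 0, 0, 1, 0], ![0, 0, 0, 0, 1], ![0, 0, 0, 0, 0]]
  | .F25 => ![![0, 1, 0, 0, 0], ![0, 0, 0, 0, 0], ![0, 0, 0, 0, 0]]
  | .F26 => ![![1, 0, 0, 0, 1], ![0, 0, 0, 0, 0], ![0, 0, 0, 0, 0]]
  | .F27 => ![![1, 0, 0, 0, 0], ![0, 0, 0, 0, 0], ![0, 0, 0, 0, 0]]
  | .F28 => ![![0, 0, 0, 1, 0], ![0, 0, 0, 0, 0], ![0, 0, 0, 0, 0]]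
  | .F29 => ![![0, 0, 0, 0, 0], ![0, 0, 0, 0, 0], ![0, 0, 0, 0, 0]]

theorem cls_mxx : cls mxx = ![1, 0, 0, 0, 0] := rfl
theorem cls_mxy : cls mxy = ![0, 1, 0, 0, 0] := rfl
theorem cls_myy : cls myy = ![0, 0, 1, 0, 0] := rfl
theorem cls_mx : cls mx = ![0, 0, 0, 1, 0] := rfl
theorem cls_my : cls my = ![0, 0, 0, 0, 1] := rfl
theorem vec_zero : (![0, 0, 0, 0, 0] : Cls) = 0 := by simp

theorem cls_rep (a : Label) : (fun j => cls (a.rep j)) = a.gens := by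
  cases a <;> (ext1 j; revert j; unfold Label.rep Label.gens Label.dim; intro j; fin_cases j) <;>
    first
    | rfl
    | simp [cls_mxx, cls_mxy, cls_myy, cls_mx, cls_my, sub_eq_add_neg]

end QuadOrbits

/-! ### Explicit degenerations along the edges of the diagram. -/

namespace QuadOrbits

open Set Filter Topology

theorem vec_ext {p q r u v p' q' r' u' v' : ℂ} (hp : p = p') (hq : q = q') (hr : r = r')
    (hu : u = u') (hv : v = v') : (![p, q, r, u, v] : Cls) = ![p', q', r', u', v'] := by
  rw [hp, hq, hr, hu, hv]

theorem eq_sum_pull {f u₀ u₁ u₂ : Cls} (R : Chart) {p q r : ℂ}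
    (h : f = p • R.pull u₀ + q • R.pull u₁ + r • R.pull u₂) :
    f = ∑ j, ![p, q, r] j • R.pull (![u₀, u₁, u₂] j) := by
  simpa [Fin.sum_univ_succ, add_assoc] using h

/-- A degeneration of triples along an explicit curve. -/
theorem Degen.of_curve₃ {u₀ u₁ u₂ v₀ v₁ v₂ : Cls} (R : ∀ t : ℂ, t ≠ 0 → Chart)
    (A : ℂ → Fin 3 → Fin 3 → ℂ) (P₀ P₁ P₂ : ℂ → Cls)
    (h : ∀ t ht,
      P₀ t = A t 0 0 • (R t ht).pull u₀ + A t 0 1 • (R t ht).pull u₁ + A t 0 2 • (R t ht).pull u₂ ∧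
      P₁ t = A t 1 0 • (R t ht).pull u₀ + A t 1 1 • (R t ht).pull u₁ + A t 1 2 • (R t ht).pull u₂ ∧
      P₂ t = A t 2 0 • (R t ht).pull u₀ + A t 2 1 • (R t ht).pull u₁ + A t 2 2 • (R t ht).pull u₂
      := by
        intro t ht
        simp only [Chart.pull_vec, Matrix.smul_cons, Matrix.cons_add_cons, Matrix.smul_empty,
          Matrix.empty_add_empty, smul_eq_mul, Matrix.cons_val]
        refine ⟨vec_ext ?_ ?_ ?_ ?_ ?_, vec_ext ?_ ?_ ?_ ?_ ?_, vec_ext ?_ ?_ ?_ ?_ ?_⟩ <;>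
        first
        | ring1
        | (field_simp; ring1)
        | field_simp)
    (hP : Continuous fun t => (P₀ t, P₁ t, P₂ t) := by fun_prop)
    (h0 : (P₀ 0, P₁ 0, P₂ 0) = (v₀, v₁, v₂) := by simp) :
    Degen ![v₀, v₁, v₂] ![u₀, u₁, u₂] := by
  refine .of_curve (fun t => ![P₀ t, P₁ t, P₂ t]) ?_ ?_ fun t ht => ?_
  · have h0 := hP.fst
    have h1 := hP.snd.fst
    have h2 := hP.snd.snd
    refine continuous_pi fun i => ?_
    fin_cases i <;> assumption
  · simp only [Prod.mk.injEq] at h0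
    rw [h0.1, h0.2.1, h0.2.2]
  · obtain ⟨h0, h1, h2⟩ := h t ht
    refine ⟨R t ht, fun i => ![A t i 0, A t i 1, A t i 2], fun i => ?_⟩
    fin_cases i
    exacts [eq_sum_pull _ h0, eq_sum_pull _ h1, eq_sum_pull _ h2]

/-- A triple of combinations of the members of a triple. -/
theorem Degen.of_comb₃ {u₀ u₁ u₂ v₀ v₁ v₂ : Cls} (A : Fin 3 → Fin 3 → ℂ)
    (h : v₀ = A 0 0 • u₀ + A 0 1 • u₁ + A 0 2 • u₂ ∧ v₁ = A 1 0 • u₀ + A 1 1 • u₁ + A 1 2 • u₂ ∧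
      v₂ = A 2 0 • u₀ + A 2 1 • u₁ + A 2 2 • u₂ := by simp) :
    Degen ![v₀, v₁, v₂] ![u₀, u₁, u₂] := by
  refine .of_comb Chart.one (fun i => ![A i 0, A i 1, A i 2]) fun i => ?_
  obtain ⟨h0, h1, h2⟩ := h
  fin_cases i <;> refine eq_sum_pull _ ?_ <;> simpa only [Chart.pull_one]

theorem degen_F2_F1 : Degen (Label.gens .F2) (Label.gens .F1) :=
  .of_curve₃ (fun t ht => ⟨(3 * t + 4) / (8 * t), (3 * t - 4) / (8 * t), 1 / 8,
    (3 * t - 4) / (8 * t), (3 * t + 4) / (8 * t), 1 / 8,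
      ne_of_eq_of_ne (b := 3 / (4 * t)) (by field_simp; ring) (by simp [ht])⟩)
    (fun t => ![![1 / 4 * t ^ 2 + 2 / 3 * t + 4 / 9, 1 / 4 * t ^ 2 - 2 / 3 * t + 4 / 9,
      -1 / 2 * t ^ 2 + 8 / 9], ![1 / 4 * t ^ 2 - 2 / 3 * t + 4 / 9,
      1 / 4 * t ^ 2 + 2 / 3 * t + 4 / 9, -1 / 2 * t ^ 2 + 8 / 9], ![-1 / 4 * t ^ 2 + 4 / 9,
      -1 / 4 * t ^ 2 + 4 / 9, 1 / 2 * t ^ 2 + 8 / 9]])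
    (fun t => ![1, 0, 0, 3 / 16 * t ^ 2, 3 / 16 * t ^ 2 + 1]) (fun t => ![0, 0, 1,
      3 / 16 * t ^ 2 + 1, 3 / 16 * t ^ 2])
    (fun t => ![0, 1, 0, -3 / 16 * t ^ 2 + 1 / 2, -3 / 16 * t ^ 2 + 1 / 2])

theorem degen_F5_F1 : Degen (Label.gens .F5) (Label.gens .F1) := by
  -- The equation `s² = -1/3` makes `(1 + s)³ + (1 - s)³ = 2 + 6s²` vanish. The cubic form of `F1`
  -- is proportional to `p³ + q³`, that of `F5` to `pq(p + q)`; the substitution below matches their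
  -- three roots.
  obtain ⟨s, hs⟩ := IsAlgClosed.exists_pow_nat_eq (-1 / 3 : ℂ) two_pos
  have hs0 : s ≠ 0 := by rintro rfl; norm_num at hs
  refine .of_curve₃
    (fun t ht => ⟨3 * t * (1 + s) / 4, 3 * t * (1 - s) / 4, 1 / 2, 3 * t * (1 - s) / 4,
      3 * t * (1 + s) / 4, 1 / 2,
      ne_of_eq_of_ne (b := 9 * t ^ 2 * s / 4) (by ring) (by simp [ht, hs0])⟩)
    (fun t => ![![(-2 - 6 * s) / (9 * t ^ 2), (-2 + 6 * s) / (9 * t ^ 2), 8 / (9 * t ^ 2)],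
      ![(-2 + 6 * s) / (9 * t ^ 2), (-2 - 6 * s) / (9 * t ^ 2), 8 / (9 * t ^ 2)],
      ![4 / (9 * t), 4 / (9 * t), -4 / (9 * t)]])
    (fun _ => ![1, 0, 0, 0, 0]) (fun _ => ![0, 0, 1, 0, 0]) (fun t => ![0, t, 0, 1, 1]) ?_
  intro t ht
  simp only [Chart.pull_vec, Matrix.smul_cons, Matrix.cons_add_cons, Matrix.smul_empty,
    Matrix.empty_add_empty, smul_eq_mul, Matrix.cons_val]
  refine ⟨vec_ext ?_ ?_ ?_ ?_ ?_, vec_ext ?_ ?_ ?_ ?_ ?_, vec_ext ?_ ?_ ?_ ?_ ?_⟩ <;>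
  first
  | ring1
  | (field_simp; ring1)
  | (field_simp; ring_nf; simp only [hs]; ring_nf)

/-- The span of `F2` is symmetric in `x` and `y`: it is generated by `(x - y)²`, `(x + y)² + 2(x +
y)` and `(x² - y²) - (x - y)`. The substitutions for `F3`, `F6` and `F8` prescribe `x - y` and `x +
y`. -/
theorem degen_F3_F2 : Degen (Label.gens .F3) (Label.gens .F2) :=
  .of_curve₃ (fun t ht => ⟨(t ^ 2 + 4) / (2 * t ^ 2), 2 / t, 1 / 2, (-t ^ 2 + 4) / (2 * t ^ 2),
    2 / t, 1 / 2, ne_of_eq_of_ne (b := 2 / t) (by field_simp; ring) (by simp [ht])⟩)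
    (fun t => ![![1, 1, -2], ![(t ^ 4 - 8 * t ^ 2 + 16) / (16 * t ^ 2),
      (t ^ 4 + 8 * t ^ 2 + 16) / (16 * t ^ 2), (t ^ 4 - 16) / (8 * t ^ 2)],
      ![(t ^ 2 - 4) / (4 * t), (-t ^ 2 - 4) / (4 * t), 2 / t]])
    (fun _ => ![1, 0, 0, 0, 0]) (fun t => ![0, 0, 1, 1, t])
    (fun _ => ![0, 1, 0, 0, 0])

theorem degen_F6_F2 : Degen (Label.gens .F6) (Label.gens .F2) :=
  .of_curve₃ (fun t ht => ⟨1 / 2, 2 * t ^ 2, (-2 * t + 1) / (4 * t), -1 / 2, 2 * t ^ 2,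
    (-2 * t - 1) / (4 * t), ne_of_eq_of_ne (b := 2 * t ^ 2) (by field_simp; ring) (by simp [ht])⟩)
    (fun t => ![![(2 * t + 1) / (2 * t), (2 * t - 1) / (2 * t), -2], ![1 / (16 * t ^ 4),
      1 / (16 * t ^ 4), 1 / (8 * t ^ 4)], ![-1 / 2, 1 / 2, 0]])
    (fun t => ![1, 2 * t, 0, 0, 1]) (fun _ => ![0, 0, 1, 0, 0])
    (fun t => ![0, -2 * t ^ 2, 0, 1, -t])

theorem degen_F8_F2 : Degen (Label.gens .F8) (Label.gens .F2) :=
  .of_curve₃ (fun t ht => ⟨1 / 2, 2 * t, 1 / 2, -1 / 2, 2 * t, 1 / 2,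
    ne_of_eq_of_ne (b := 2 * t) (by field_simp; ring) (by simp [ht])⟩)
    (fun t => ![![1, 1, -2], ![1 / (4 * t), -1 / (4 * t), 0], ![1 / (16 * t), 1 / (16 * t),
      1 / (8 * t)]])
    (fun _ => ![1, 0, 0, 0, 0]) (fun _ => ![0, 1, 0, 0, 0])
    (fun t => ![0, 0, t, 0, 1])

theorem degen_F4_F3 : Degen (Label.gens .F4) (Label.gens .F3) :=
  .of_curve₃ (fun t ht => ⟨t, 0, 0, 0, 1, 0, by simp [ht]⟩)
    (fun t => ![![1 / t ^ 2, 0, 0], ![0, 1, 0], ![0, 0, 1 / t]])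
    (fun _ => ![1, 0, 0, 0, 0]) (fun t => ![0, 0, 1, t, 0])
    (fun _ => ![0, 1, 0, 0, 0])

theorem degen_F7_F3 : Degen (Label.gens .F7) (Label.gens .F3) :=
  .of_curve₃ (fun t ht => ⟨4, 4, -4, 1, -1, 0,
    ne_of_eq_of_ne (b := -8) (by field_simp; ring) (by simp)⟩)
    (fun _ => ![![1 / 64, 1 / 4, 1 / 8], ![1 / 64, 1 / 4, -1 / 8], ![0, 0, 0]])
    (fun _ => ![1, 0, 0, 0, 1]) (fun _ => ![0, 0, 1, 1, 0])
    (fun _ => ![0, 0, 0, 0, 0])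

theorem degen_F9_F3 : Degen (Label.gens .F9) (Label.gens .F3) :=
  .of_curve₃ (fun t ht => ⟨1 / t ^ 6, 0, 1 / (2 * t ^ 8), 0, 1, -1 / (2 * t ^ 4), by simp [ht]⟩)
    (fun t => ![![t ^ 12, -t ^ 4, 0], ![0, 1 / 2 * t ^ 2, t ^ 6], ![0, t ^ 6, 0]])
    (fun t => ![1, 0, -t ^ 4, 0, 1]) (fun t => ![0, 1, 1 / 2 * t ^ 2, 0, 0])
    (fun t => ![0, 0, t ^ 6, 1, -t ^ 2])

theorem degen_F14_F3 : Degen (Label.gens .F14) (Label.gens .F3) :=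
  .of_curve₃ (fun t ht => ⟨1 / t ^ 2, 0, 0, 0, 1, 0, by simp [ht]⟩)
    (fun t => ![![t ^ 4, 0, 0], ![0, 0, t ^ 2], ![0, t ^ 2, 0]])
    (fun _ => ![1, 0, 0, 0, 0]) (fun _ => ![0, 1, 0, 0, 0])
    (fun t => ![0, 0, t ^ 2, 1, 0])

theorem degen_F13_F4 : Degen (Label.gens .F13) (Label.gens .F4) :=
  .of_comb₃ ![![1, 0, 0], ![0, 1, 0], ![0, 0, 0]]

theorem degen_F18_F4 : Degen (Label.gens .F18) (Label.gens .F4) :=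
  .of_curve₃ (fun t ht => ⟨1, 0, 0, 0, 1, 1 / t, by simp⟩)
    (fun t => ![![1, 0, 0], ![0, 0, t], ![0, 1 / 2 * t, 0]])
    (fun _ => ![1, 0, 0, 0, 0]) (fun t => ![0, t, 0, 1, 0])
    (fun t => ![0, 0, 1 / 2 * t, 0, 1])

theorem degen_F25_F4 : Degen (Label.gens .F25) (Label.gens .F4) :=
  .of_comb₃ ![![0, 0, 1], ![0, 0, 0], ![0, 0, 0]]

theorem degen_F6_F5 : Degen (Label.gens .F6) (Label.gens .F5) :=
  .of_curve₃ (fun t ht => ⟨1, 0, 1 / (2 * t), 0, -t, 0, by simp [ht]⟩)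
    (fun t => ![![1, 0, -1 / t], ![0, 1 / t ^ 2, 0], ![0, 0, 1]])
    (fun _ => ![1, 0, 0, 0, 1]) (fun _ => ![0, 0, 1, 0, 0])
    (fun t => ![0, 0, 0, 1, -t])

theorem degen_F8_F5 : Degen (Label.gens .F8) (Label.gens .F5) :=
  .of_curve₃ (fun t ht => ⟨1, 0, 0, -1, t, 0, by simp [ht]⟩)
    (fun t => ![![1, 0, 0], ![1 / (2 * t), -1 / (2 * t), 0], ![0, 0, 1 / t]])
    (fun _ => ![1, 0, 0, 0, 0]) (fun t => ![0, 1, -1 / 2 * t, 0, 0])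
    (fun _ => ![0, 0, 0, 0, 1])

theorem degen_F7_F6 : Degen (Label.gens .F7) (Label.gens .F6) :=
  .of_comb₃ ![![1, 0, 0], ![0, 1, 1], ![0, 0, 0]]

theorem degen_F9_F6 : Degen (Label.gens .F9) (Label.gens .F6) :=
  .of_curve₃ (fun t ht => ⟨1, 0, 1 / (2 * t), 1 / t, 1, 1 / (2 * t ^ 2), by simp⟩)
    (fun t => ![![1, 0, -2 / t], ![-1 / (2 * t), 1 / 2 * t, 1 / (2 * t ^ 2)], ![0, 0, 1]])
    (fun _ => ![1, 0, 0, 0, 1]) (fun t => ![0, 1, 1 / 2 * t, 0, 0])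
    (fun _ => ![0, 0, 0, 1, 0])

theorem degen_F11_F6 : Degen (Label.gens .F11) (Label.gens .F6) :=
  .of_curve₃ (fun t ht => ⟨0, 1, 0, t, 0, 0,
    ne_of_eq_of_ne (b := -t) (by field_simp; ring) (by simp [ht])⟩)
    (fun t => ![![0, 1 / t ^ 2, 0], ![1, 0, 0], ![0, 0, 1]])
    (fun _ => ![1, 0, 0, 0, 0]) (fun t => ![0, 0, 1, t, 0])
    (fun _ => ![0, 0, 0, 0, 1])

theorem degen_F10_F7 : Degen (Label.gens .F10) (Label.gens .F7) :=
  .of_curve₃ (fun t ht => ⟨t, 0, 1 / 2, -t, t ^ 2, 1 / 2, by simp [ht]⟩)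
    (fun t => ![![1 / t ^ 2, 0, 0], ![1 / (2 * t ^ 3), -1 / (2 * t ^ 3), 0], ![0, 0, 0]])
    (fun _ => ![1, 0, 0, 0, 1]) (fun t => ![0, 1, -1 / 2 * t, 0, 0])
    (fun _ => ![0, 0, 0, 0, 0])

theorem degen_F12_F7 : Degen (Label.gens .F12) (Label.gens .F7) :=
  .of_curve₃ (fun t ht => ⟨1 / t, 0, 0, 0, 1 / t ^ 2, 0, by simp [ht]⟩)
    (fun t => ![![t ^ 2, 0, 0], ![0, t ^ 4, 0], ![0, 0, 0]])
    (fun _ => ![1, 0, 0, 0, 1]) (fun t => ![0, 0, 1, t ^ 3, 0])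
    (fun _ => ![0, 0, 0, 0, 0])

theorem degen_F9_F8 : Degen (Label.gens .F9) (Label.gens .F8) :=
  .of_curve₃ (fun t ht => ⟨1, 0, -1 / (2 * t), 1, t, -1 / t, by simp [ht]⟩)
    (fun t => ![![1, 0, 1 / t], ![-1 / t, 1 / t, 1 / (2 * t ^ 2)], ![0, 0, 1]])
    (fun _ => ![1, 0, 0, 0, 1]) (fun _ => ![0, 1, 0, 0, 0])
    (fun t => ![0, 0, 0, 1, t])

theorem degen_F10_F9 : Degen (Label.gens .F10) (Label.gens .F9) :=
  .of_comb₃ ![![1, 0, 0], ![0, 1, 0], ![0, 0, 0]]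

theorem degen_F14_F9 : Degen (Label.gens .F14) (Label.gens .F9) :=
  .of_curve₃ (fun t ht => ⟨1, 0, 0, 0, t, 0, by simp [ht]⟩)
    (fun t => ![![1, 0, 0], ![0, 1 / t, 0], ![0, 0, 1]])
    (fun t => ![1, 0, 0, 0, t]) (fun _ => ![0, 1, 0, 0, 0])
    (fun _ => ![0, 0, 0, 1, 0])

theorem degen_F17_F9 : Degen (Label.gens .F17) (Label.gens .F9) :=
  .of_curve₃ (fun t ht => ⟨t, 0, 0, 0, 1, 0, by simp [ht]⟩)
    (fun t => ![![0, 1 / t, 0], ![0, 0, 1 / t], ![1, 0, 0]])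
    (fun _ => ![0, 1, 0, 0, 0]) (fun _ => ![0, 0, 0, 1, 0])
    (fun t => ![t ^ 2, 0, 0, 0, 1])

theorem degen_F15_F10 : Degen (Label.gens .F15) (Label.gens .F10) :=
  .of_curve₃ (fun t ht => ⟨1, 0, -1 / 3, -1 / 3, t, 2 / 9, by simp [ht]⟩)
    (fun t => ![![1, 0, 0], ![1 / (3 * t), 1 / t, 0], ![0, 0, 0]])
    (fun t => ![1, 0, 0, -1, t]) (fun _ => ![0, 1, 0, 0, 0])
    (fun _ => ![0, 0, 0, 0, 0])

theorem degen_F19_F10 : Degen (Label.gens .F19) (Label.gens .F10) :=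
  .of_curve₃ (fun t ht => ⟨1, 0, 1 / (3 * t), 1 / (3 * t), 1 / t, 2 / (9 * t ^ 2), by simp [ht]⟩)
    (fun t => ![![-1 / 3, t, 0], ![t, 0, 0], ![0, 0, 0]])
    (fun _ => ![0, 1, 0, 0, 0]) (fun t => ![t, 0, 0, 1, 1])
    (fun _ => ![0, 0, 0, 0, 0])

theorem degen_F12_F11 : Degen (Label.gens .F12) (Label.gens .F11) :=
  .of_comb₃ ![![1, 0, 1], ![0, 1, 0], ![0, 0, 0]]

theorem degen_F14_F11 : Degen (Label.gens .F14) (Label.gens .F11) :=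
  .of_curve₃ (fun t ht => ⟨1, t, 0, 1, 0, 0,
    ne_of_eq_of_ne (b := -t) (by field_simp; ring) (by simp [ht])⟩)
    (fun t => ![![0, 1, 0], ![1 / (2 * t), -1 / (2 * t), 0], ![0, 0, 1]])
    (fun _ => ![1, 0, 0, 0, 0]) (fun t => ![0, 1, 1 / 2 * t, 0, 0])
    (fun _ => ![0, 0, 0, 1, 0])

theorem degen_F13_F12 : Degen (Label.gens .F13) (Label.gens .F12) :=
  .of_curve₃ (fun t ht => ⟨1, 0, 0, 0, t, 0, by simp [ht]⟩)
    (fun t => ![![1, 0, 0], ![0, 1 / t ^ 2, 0], ![0, 0, 0]])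
    (fun t => ![1, 0, 0, 0, t]) (fun _ => ![0, 0, 1, 0, 0])
    (fun _ => ![0, 0, 0, 0, 0])

theorem degen_F15_F12 : Degen (Label.gens .F15) (Label.gens .F12) :=
  .of_curve₃ (fun t ht => ⟨1, 0, 0, -1, t, 1 / 2, by simp [ht]⟩)
    (fun t => ![![1, 0, 0], ![1 / (2 * t), -1 / (2 * t), 0], ![0, 0, 0]])
    (fun t => ![1, 0, 0, -1, t]) (fun t => ![0, 1, -1 / 2 * t, 0, 0])
    (fun _ => ![0, 0, 0, 0, 0])

theorem degen_F19_F12 : Degen (Label.gens .F19) (Label.gens .F12) :=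
  .of_curve₃ (fun t ht => ⟨1, -1, 0, 1 / t, 1 / t, 1 / (2 * t ^ 2),
    ne_of_eq_of_ne (b := 2 / t) (by field_simp; ring) (by simp [ht])⟩)
    (fun t => ![![-1 / 4, 1 / 4 * t ^ 2, 0], ![1 / 2 * t, 1 / 2 * t ^ 3, 0], ![0, 0, 0]])
    (fun _ => ![0, 1, 0, 0, 0]) (fun t => ![t, 0, t, 1, 1])
    (fun _ => ![0, 0, 0, 0, 0])

theorem degen_F16_F13 : Degen (Label.gens .F16) (Label.gens .F13) :=
  .of_curve₃ (fun t ht => ⟨1, 0, 0, 1, t, 0, by simp [ht]⟩)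
    (fun t => ![![1, 0, 0], ![-1 / (2 * t), 1 / (2 * t), 0], ![0, 0, 0]])
    (fun _ => ![1, 0, 0, 0, 0]) (fun t => ![0, 1, 1 / 2 * t, 0, 0])
    (fun _ => ![0, 0, 0, 0, 0])

theorem degen_F21_F13 : Degen (Label.gens .F21) (Label.gens .F13) :=
  .of_curve₃ (fun t ht => ⟨1, 0, 0, 0, 1, 1 / t, by simp⟩)
    (fun t => ![![1, 0, 0], ![0, 1 / 2 * t, 0], ![0, 0, 0]])
    (fun _ => ![1, 0, 0, 0, 0]) (fun t => ![0, 0, 1 / 2 * t, 0, 1])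
    (fun _ => ![0, 0, 0, 0, 0])

theorem degen_F15_F14 : Degen (Label.gens .F15) (Label.gens .F14) :=
  .of_comb₃ ![![1, 0, -1], ![0, 1, 0], ![0, 0, 0]]

theorem degen_F18_F14 : Degen (Label.gens .F18) (Label.gens .F14) :=
  .of_curve₃ (fun t ht => ⟨1, 0, 1 / t, 0, 1, 0, by simp⟩)
    (fun t => ![![1, 0, -2 / t], ![0, 0, 1], ![0, t, 0]])
    (fun _ => ![1, 0, 0, 0, 0]) (fun _ => ![0, 0, 0, 1, 0])
    (fun t => ![0, t, 0, 0, 1])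

theorem degen_F16_F15 : Degen (Label.gens .F16) (Label.gens .F15) :=
  .of_curve₃ (fun t ht => ⟨1 / t, 0, 0, 0, 1, 0, by simp [ht]⟩)
    (fun t => ![![t ^ 2, 0, 0], ![0, t, 0], ![0, 0, 0]])
    (fun t => ![1, 0, 0, -t, 0]) (fun _ => ![0, 1, 0, 0, 0])
    (fun _ => ![0, 0, 0, 0, 0])

theorem degen_F20_F15 : Degen (Label.gens .F20) (Label.gens .F15) :=
  .of_curve₃ (fun t ht => ⟨t, 0, 0, 0, 1, 0, by simp [ht]⟩)
    (fun t => ![![-1 / t, 0, 0], ![0, 1 / t, 0], ![0, 0, 0]])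
    (fun t => ![-t, 0, 0, 1, 0]) (fun _ => ![0, 1, 0, 0, 0])
    (fun _ => ![0, 0, 0, 0, 0])

theorem degen_F21_F15 : Degen (Label.gens .F21) (Label.gens .F15) :=
  .of_curve₃ (fun t ht => ⟨t, 0, 1 / 2, 0, 1, 0, by simp [ht]⟩)
    (fun t => ![![1 / t ^ 2, 0, 0], ![0, 2, 0], ![0, 0, 0]])
    (fun _ => ![1, 0, 0, 0, 0]) (fun t => ![0, 2 * t, 0, 0, 1])
    (fun _ => ![0, 0, 0, 0, 0])

theorem degen_F22_F16 : Degen (Label.gens .F22) (Label.gens .F16) :=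
  .of_curve₃ (fun t ht => ⟨1, 0, 1 / t, 0, 1, -2 / t ^ 2, by simp⟩)
    (fun t => ![![1, t, 0], ![0, -1 / 2 * t ^ 2, 0], ![0, 0, 0]])
    (fun t => ![1, t, 0, 0, 1]) (fun t => ![0, -1 / 2 * t ^ 2, 0, 1, -1 / 2 * t])
    (fun _ => ![0, 0, 0, 0, 0])

theorem degen_F23_F16 : Degen (Label.gens .F23) (Label.gens .F16) :=
  .of_curve₃ (fun t ht => ⟨1, 0, 0, 0, 1, 1 / t, by simp⟩)
    (fun t => ![![1, 0, 0], ![0, t, 0], ![0, 0, 0]])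
    (fun _ => ![1, 0, 0, 0, 0]) (fun t => ![0, t, 0, 1, 0])
    (fun _ => ![0, 0, 0, 0, 0])

theorem degen_F25_F16 : Degen (Label.gens .F25) (Label.gens .F16) :=
  .of_comb₃ ![![0, 1, 0], ![0, 0, 0], ![0, 0, 0]]

theorem degen_F18_F17 : Degen (Label.gens .F18) (Label.gens .F17) :=
  .of_curve₃ (fun t ht => ⟨1, 0, 0, 1, t, 0, by simp [ht]⟩)
    (fun t => ![![1, 0, 0], ![0, 1, 0], ![0, -1 / t, 1 / t]])
    (fun t => ![1, t, 0, 0, 0]) (fun _ => ![0, 0, 0, 1, 0])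
    (fun _ => ![0, 0, 0, 0, 1])

theorem degen_F19_F17 : Degen (Label.gens .F19) (Label.gens .F17) :=
  .of_comb₃ ![![1, 0, 0], ![0, 1, 1], ![0, 0, 0]]

theorem degen_F21_F18 : Degen (Label.gens .F21) (Label.gens .F18) :=
  .of_comb₃ ![![1, 0, 0], ![0, 0, 1], ![0, 0, 0]]

theorem degen_F23_F18 : Degen (Label.gens .F23) (Label.gens .F18) :=
  .of_comb₃ ![![1, 0, 0], ![0, 1, 0], ![0, 0, 0]]

theorem degen_F20_F19 : Degen (Label.gens .F20) (Label.gens .F19) :=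
  .of_curve₃ (fun t ht => ⟨1, 0, 0, 0, t, 0, by simp [ht]⟩)
    (fun t => ![![0, 1, 0], ![1 / t, 0, 0], ![0, 0, 0]])
    (fun t => ![0, 0, 0, 1, t]) (fun _ => ![0, 1, 0, 0, 0])
    (fun _ => ![0, 0, 0, 0, 0])

theorem degen_F21_F19 : Degen (Label.gens .F21) (Label.gens .F19) :=
  .of_curve₃ (fun t ht => ⟨1, 0, 0, -1, t, 0, by simp [ht]⟩)
    (fun t => ![![-1, 0, 0], ![0, 1 / t, 0], ![0, 0, 0]])
    (fun t => ![1, -t, 0, 0, 0]) (fun _ => ![0, 0, 0, 0, 1])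
    (fun _ => ![0, 0, 0, 0, 0])

theorem degen_F22_F20 : Degen (Label.gens .F22) (Label.gens .F20) :=
  .of_curve₃ (fun t ht => ⟨1, 0, 1 / t, 1 / t, 1, 0, by simp⟩)
    (fun t => ![![-1 / t, t, 0], ![1, 0, 0], ![0, 0, 0]])
    (fun t => ![1, t, 0, 0, 1]) (fun _ => ![0, 0, 0, 1, 0])
    (fun _ => ![0, 0, 0, 0, 0])

theorem degen_F23_F20 : Degen (Label.gens .F23) (Label.gens .F20) :=
  .of_curve₃ (fun t ht => ⟨1, 0, 0, 1, t, 0, by simp [ht]⟩)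
    (fun _ => ![![0, 1, 0], ![1, 0, 0], ![0, 0, 0]])
    (fun t => ![1, t, 0, 0, 0]) (fun _ => ![0, 0, 0, 1, 0])
    (fun _ => ![0, 0, 0, 0, 0])

theorem degen_F25_F20 : Degen (Label.gens .F25) (Label.gens .F20) :=
  .of_comb₃ ![![0, 1, 0], ![0, 0, 0], ![0, 0, 0]]

theorem degen_F22_F21 : Degen (Label.gens .F22) (Label.gens .F21) :=
  .of_curve₃ (fun t ht => ⟨1, 0, -1 / (2 * t), 1, t, 0, by simp [ht]⟩)
    (fun t => ![![1, 1 / t, 0], ![0, 1, 0], ![0, 0, 0]])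
    (fun _ => ![1, 0, 0, 0, 1]) (fun t => ![0, 0, 0, 1, t])
    (fun _ => ![0, 0, 0, 0, 0])

theorem degen_F23_F22 : Degen (Label.gens .F23) (Label.gens .F22) :=
  .of_curve₃ (fun t ht => ⟨1, 0, 0, 0, t, 0, by simp [ht]⟩)
    (fun _ => ![![1, 0, 0], ![0, 1, 0], ![0, 0, 0]])
    (fun t => ![1, 0, 0, 0, t]) (fun _ => ![0, 0, 0, 1, 0])
    (fun _ => ![0, 0, 0, 0, 0])

theorem degen_F24_F22 : Degen (Label.gens .F24) (Label.gens .F22) :=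
  .of_curve₃ (fun t ht => ⟨t, 0, 0, 0, 1, 0, by simp [ht]⟩)
    (fun t => ![![0, 1 / t, 0], ![1, 0, 0], ![0, 0, 0]])
    (fun _ => ![0, 0, 0, 1, 0]) (fun t => ![t ^ 2, 0, 0, 0, 1])
    (fun _ => ![0, 0, 0, 0, 0])

theorem degen_F26_F22 : Degen (Label.gens .F26) (Label.gens .F22) :=
  .of_comb₃ ![![1, 0, 0], ![0, 0, 0], ![0, 0, 0]]

theorem degen_F27_F23 : Degen (Label.gens .F27) (Label.gens .F23) :=
  .of_comb₃ ![![1, 0, 0], ![0, 0, 0], ![0, 0, 0]]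

theorem degen_F28_F24 : Degen (Label.gens .F28) (Label.gens .F24) :=
  .of_comb₃ ![![1, 0, 0], ![0, 0, 0], ![0, 0, 0]]

theorem degen_F26_F25 : Degen (Label.gens .F26) (Label.gens .F25) :=
  .of_curve₃ (fun t ht => ⟨1, 0, 1 / t, 1, t, -1 / t, by simp [ht]⟩)
    (fun _ => ![![1, 0, 0], ![0, 0, 0], ![0, 0, 0]])
    (fun t => ![1, t, 0, 0, 1]) (fun _ => ![0, 0, 0, 0, 0])
    (fun _ => ![0, 0, 0, 0, 0])

theorem degen_F27_F26 : Degen (Label.gens .F27) (Label.gens .F26) :=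
  .of_curve₃ (fun t ht => ⟨1, 0, 0, 0, t, 0, by simp [ht]⟩)
    (fun _ => ![![1, 0, 0], ![0, 0, 0], ![0, 0, 0]])
    (fun t => ![1, 0, 0, 0, t]) (fun _ => ![0, 0, 0, 0, 0])
    (fun _ => ![0, 0, 0, 0, 0])

theorem degen_F28_F27 : Degen (Label.gens .F28) (Label.gens .F27) :=
  .of_curve₃ (fun t ht => ⟨1, 0, 1 / t, 0, 1, 0, by simp⟩)
    (fun t => ![![1 / 2 * t, 0, 0], ![0, 0, 0], ![0, 0, 0]])
    (fun t => ![1 / 2 * t, 0, 0, 1, 0]) (fun _ => ![0, 0, 0, 0, 0])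
    (fun _ => ![0, 0, 0, 0, 0])

theorem degen_F29_F28 : Degen (Label.gens .F29) (Label.gens .F28) :=
  .of_comb₃ ![![0, 0, 0], ![0, 0, 0], ![0, 0, 0]]

theorem degen_G1_G0 : Degen (Label.gens .G1) (Label.gens .G0) := by
  refine .of_comb (m := 4) (k := 5) Chart.one
    ![![1, 0, 0, 0, 1], ![0, 0, 1, 0, 0], ![0, 1, 0, 0, 0], ![0, 0, 0, 1, 0]] fun i => ?_
  fin_cases i <;> simp [Fin.sum_univ_succ, Label.gens, Chart.pull_one]

theorem degen_G2_G1 : Degen (Label.gens .G2) (Label.gens .G1) := by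
  refine .of_curve (m := 4) (k := 4)
    (fun t => ![![1, 0, 0, 0, t], ![0, 0, 1, 0, 0], ![0, 1, 0, 0, 0], ![0, 0, 0, 1, 0]])
    (by fun_prop) rfl fun t ht => ⟨⟨1, 0, 0, 0, t, 0, by simp [ht]⟩,
      ![![1, 0, 0, 0], ![0, 1 / t ^ 2, 0, 0], ![0, 0, 1 / t, 0], ![0, 0, 0, 1]], fun i => ?_⟩
  fin_cases i <;> simp [Fin.sum_univ_succ, Label.gens, Chart.pull_vec, ht]

theorem degen_G3_G2 : Degen (Label.gens .G3) (Label.gens .G2) := by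
  refine .of_curve (m := 4) (k := 4)
    (fun t => ![![1, 0, 0, 0, 0], ![0, 0, 1, 0, 0], ![0, 0, 0, 1, 0], ![0, -t, 0, 0, 1]])
    (by fun_prop) (by simp; rfl) fun t ht => ⟨⟨1, 0, -1 / t, 0, 1, 0, by simp⟩,
      ![![1, 0, 0, 2 / t], ![0, 1, 0, 0], ![0, 0, 0, 1], ![0, 0, -t, 0]], fun i => ?_⟩
  fin_cases i <;> simp [Fin.sum_univ_succ, Label.gens, Chart.pull_vec, ht, div_eq_mul_inv]

theorem degen_F1_G2 : Degen (Label.gens .F1) (Label.gens .G2) := by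
  -- For `X = x + y - 1` and `Y = x - y` one has `X + Y = 2x - 1` and `X - Y = 2y - 1`. The squares
  -- and the product of these, divided by 4, differ from the generators of `F1` by multiples of `X`
  -- and constants.
  refine .of_comb (m := 3) (k := 4) ⟨1, 1, -1, 1, -1, 0, by norm_num⟩
    ![![1 / 4, 1 / 4, 1 / 2, 1], ![1 / 4, 1 / 4, -1 / 2, 1], ![1 / 4, -1 / 4, 0, 1 / 2]] fun i => ?_
  fin_cases i <;> simp [Fin.sum_univ_succ, Label.gens, Chart.pull_vec] <;> norm_num

theorem degen_G4_G3 : Degen (Label.gens .G4) (Label.gens .G3) := by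
  refine .of_curve (m := 4) (k := 4)
    (fun t => ![![1, 0, 0, 0, 0], ![0, 1, 1 / 2 * t, 0, 0], ![0, 0, 0, 1, 0], ![0, 0, 0, 0, 1]])
    (by fun_prop) (by simp; rfl) fun t ht => ⟨⟨1, 0, 0, 1, t, 0, by simp [ht]⟩,
      ![![1, 0, 0, 0], ![-1 / (2 * t), 1 / (2 * t), 0, 0], ![0, 0, 1, 0], ![0, 0, -1 / t, 1 / t]],
      fun i => ?_⟩
  fin_cases i <;> simp [Fin.sum_univ_succ, Label.gens, Chart.pull_vec] <;> field_simp <;> simp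

theorem degen_F5_G3 : Degen (Label.gens .F5) (Label.gens .G3) := by
  refine .of_comb (m := 3) (k := 4) Chart.one
    ![![1, 0, 0, 0], ![0, 1, 0, 0], ![0, 0, 1, 1]] fun i => ?_
  fin_cases i <;> simp [Fin.sum_univ_succ, Label.gens, Chart.pull_one]

theorem degen_F8_G4 : Degen (Label.gens .F8) (Label.gens .G4) := by
  refine .of_comb (m := 3) (k := 4) Chart.one
    ![![1, 0, 0, 0], ![0, 1, 0, 0], ![0, 0, 0, 1]] fun i => ?_
  fin_cases i <;> simp [Fin.sum_univ_succ, Label.gens, Chart.pull_one]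

theorem degen_of_mem_below {a b : Label} (h : a ∈ below b) : Degen a.gens b.gens := by
  cases b <;> simp only [below, List.mem_cons, List.not_mem_nil, or_false] at h
  · subst h; exact degen_G1_G0
  · subst h; exact degen_G2_G1
  · rcases h with rfl | rfl
    exacts [degen_G3_G2, degen_F1_G2]
  · rcases h with rfl | rfl
    exacts [degen_G4_G3, degen_F5_G3]
  · subst h; exact degen_F8_G4
  · rcases h with rfl | rfl
    exacts [degen_F2_F1, degen_F5_F1]
  · rcases h with rfl | rfl | rfl
    exacts [degen_F3_F2, degen_F6_F2, degen_F8_F2]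
  · rcases h with rfl | rfl | rfl | rfl
    exacts [degen_F4_F3, degen_F7_F3, degen_F9_F3, degen_F14_F3]
  · rcases h with rfl | rfl | rfl
    exacts [degen_F13_F4, degen_F18_F4, degen_F25_F4]
  · rcases h with rfl | rfl
    exacts [degen_F6_F5, degen_F8_F5]
  · rcases h with rfl | rfl | rfl
    exacts [degen_F7_F6, degen_F9_F6, degen_F11_F6]
  · rcases h with rfl | rfl
    exacts [degen_F10_F7, degen_F12_F7]
  · subst h; exact degen_F9_F8
  · rcases h with rfl | rfl | rfl
    exacts [degen_F10_F9, degen_F14_F9, degen_F17_F9]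
  · rcases h with rfl | rfl
    exacts [degen_F15_F10, degen_F19_F10]
  · rcases h with rfl | rfl
    exacts [degen_F12_F11, degen_F14_F11]
  · rcases h with rfl | rfl | rfl
    exacts [degen_F13_F12, degen_F15_F12, degen_F19_F12]
  · rcases h with rfl | rfl
    exacts [degen_F16_F13, degen_F21_F13]
  · rcases h with rfl | rfl
    exacts [degen_F15_F14, degen_F18_F14]
  · rcases h with rfl | rfl | rfl
    exacts [degen_F16_F15, degen_F20_F15, degen_F21_F15]
  · rcases h with rfl | rfl | rfl
    exacts [degen_F22_F16, degen_F23_F16, degen_F25_F16]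
  · rcases h with rfl | rfl
    exacts [degen_F18_F17, degen_F19_F17]
  · rcases h with rfl | rfl
    exacts [degen_F21_F18, degen_F23_F18]
  · rcases h with rfl | rfl
    exacts [degen_F20_F19, degen_F21_F19]
  · rcases h with rfl | rfl | rfl
    exacts [degen_F22_F20, degen_F23_F20, degen_F25_F20]
  · subst h; exact degen_F22_F21
  · rcases h with rfl | rfl | rfl
    exacts [degen_F23_F22, degen_F24_F22, degen_F26_F22]
  · subst h; exact degen_F27_F23
  · subst h; exact degen_F28_F24
  · subst h; exact degen_F26_F25
  · subst h; exact degen_F27_F26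
  · subst h; exact degen_F28_F27
  · subst h; exact degen_F29_F28

end QuadOrbits

/-! ### Obstructions given by polynomial equations. -/

namespace QuadOrbits

open Set Filter Topology

theorem not_degen_of_isClosed {m k : ℕ} {v : Fin m → Cls} {u : Fin k → Cls}
    (S : Set (Fin m → Cls)) (hS : IsClosed S) (hv : v ∉ S)
    (h : ∀ (R : Chart) (A : Fin m → Fin k → ℂ) (f : Fin m → Cls),
      (∀ i, f i = ∑ j, A i j • R.pull (u j)) → f ∈ S) : ¬ Degen v u := fun hd =>
  hv (closure_minimal (by rintro f ⟨R, A, hf⟩; exact h R A f hf) hS hd)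

theorem not_degen₃ {m : ℕ} {v : Fin m → Cls} {u₀ u₁ u₂ : Cls}
    (S : Set (Fin m → Cls)) (hS : IsClosed S) (hv : v ∉ S)
    (h : ∀ (R : Chart) (A : Fin m → Fin 3 → ℂ) (f : Fin m → Cls),
      (∀ i, f i = A i 0 • R.pull u₀ + A i 1 • R.pull u₁ + A i 2 • R.pull u₂) → f ∈ S) :
    ¬ Degen v ![u₀, u₁, u₂] :=
  not_degen_of_isClosed S hS hv fun R A f hf => h R A f fun i => by
    simpa [Fin.sum_univ_succ, add_assoc] using hf i

theorem not_degen₄ {m : ℕ} {v : Fin m → Cls} {u₀ u₁ u₂ u₃ : Cls}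
    (S : Set (Fin m → Cls)) (hS : IsClosed S) (hv : v ∉ S)
    (h : ∀ (R : Chart) (A : Fin m → Fin 4 → ℂ) (f : Fin m → Cls),
      (∀ i, f i = A i 0 • R.pull u₀ + A i 1 • R.pull u₁ + A i 2 • R.pull u₂ + A i 3 • R.pull u₃) →
        f ∈ S) : ¬ Degen v ![u₀, u₁, u₂, u₃] :=
  not_degen_of_isClosed S hS hv fun R A f hf => h R A f fun i => by
    simpa [Fin.sum_univ_succ, add_assoc] using hf i

theorem not_degen_F28_F29 : ¬ Degen (Label.gens .F28) (Label.gens .F29) :=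
  not_degen₃ (m := 3) {f | f 0 3 = 0} (isClosed_eq (by fun_prop) (by fun_prop))
    (by simp [Label.gens])
    fun R A f hf => by simp [hf, Chart.pull_vec]

theorem not_degen_F27_F24 : ¬ Degen (Label.gens .F27) (Label.gens .F24) :=
  not_degen₃ (m := 3) {f | f 0 0 = 0} (isClosed_eq (by fun_prop) (by fun_prop))
    (by simp [Label.gens])
    fun R A f hf => by simp [hf, Chart.pull_vec]

/-- Everything derived from `F23` is a polynomial in one affine function, so its two partial
derivatives are proportional; the expression is a minor of their coefficients. -/
theorem not_degen_F26_F23 : ¬ Degen (Label.gens .F26) (Label.gens .F23) :=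
  not_degen₃ (m := 3) {f | 2 * f 0 0 * f 0 4 - f 0 1 * f 0 3 = 0}
    (isClosed_eq (by fun_prop) (by fun_prop)) (by simp [Label.gens])
    fun R A f hf => by simp [hf, Chart.pull_vec]; ring

/-- Quadratic parts derived from `F18` are multiples of one square, so their discriminant vanishes.
-/
theorem not_degen_F25_F18 : ¬ Degen (Label.gens .F25) (Label.gens .F18) :=
  not_degen₃ (m := 3) {f | f 0 1 ^ 2 - 4 * f 0 0 * f 0 2 = 0}
    (isClosed_eq (by fun_prop) (by fun_prop)) (by simp [Label.gens])
    fun R A f hf => by simp [hf, Chart.pull_vec]; ring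

/-- After a substitution, the linear parts of `x²` and of `x` are multiples of the same linear form.
-/
theorem not_degen_F24_F23 : ¬ Degen (Label.gens .F24) (Label.gens .F23) :=
  not_degen₃ (m := 3) {f | f 0 3 * f 1 4 - f 0 4 * f 1 3 = 0}
    (isClosed_eq (by fun_prop) (by fun_prop)) (by simp [Label.gens])
    fun R A f hf => by simp [hf, Chart.pull_vec]; ring

theorem not_degen_F24_F25 : ¬ Degen (Label.gens .F24) (Label.gens .F25) :=
  not_degen₃ (m := 3) {f | f 0 3 * f 1 4 - f 0 4 * f 1 3 = 0}
    (isClosed_eq (by fun_prop) (by fun_prop)) (by simp [Label.gens])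
    fun R A f hf => by simp [hf, Chart.pull_vec]; ring

theorem not_degen_F23_F25 : ¬ Degen (Label.gens .F23) (Label.gens .F25) :=
  not_degen₃ (m := 3) {f | f 0 0 * f 1 3 - f 0 3 * f 1 0 = 0}
    (isClosed_eq (by fun_prop) (by fun_prop)) (by simp [Label.gens])
    fun R A f hf => by simp [hf, Chart.pull_vec]; ring

theorem not_degen_F16_F17 : ¬ Degen (Label.gens .F16) (Label.gens .F17) :=
  not_degen₃ (m := 3) {f | f 0 0 * f 1 1 - f 0 1 * f 1 0 = 0}
    (isClosed_eq (by fun_prop) (by fun_prop)) (by simp [Label.gens])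
    fun R A f hf => by simp [hf, Chart.pull_vec]; ring

/-- The `x²`, `x` and constant coefficients of the Jacobian determinant satisfy the relation which
holds for squares of affine functions. -/
theorem not_degen_F21_F16 : ¬ Degen (Label.gens .F21) (Label.gens .F16) :=
  not_degen₃ (m := 3) {f |
      (2 * f 0 0 * f 1 4 + f 0 3 * f 1 1 - 2 * f 1 0 * f 0 4 - f 1 3 * f 0 1) ^ 2 -
      8 * (f 0 0 * f 1 1 - f 1 0 * f 0 1) * (f 0 3 * f 1 4 - f 0 4 * f 1 3) = 0}
    (isClosed_eq (by fun_prop) (by fun_prop)) (by simp [Label.gens])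
    fun R A f hf => by
      obtain ⟨a, b, c, d, e, g, h⟩ := R
      simp [hf, Chart.pull_vec]; ring

/-- The determinant of the matrix with rows `x`, `y`, `z`. -/
def det₃ (x y z : Fin 3 → ℂ) : ℂ :=
  x 0 * (y 1 * z 2 - y 2 * z 1) - x 1 * (y 0 * z 2 - y 2 * z 0) + x 2 * (y 0 * z 1 - y 1 * z 0)

theorem det₃_comb₂ (u v : Fin 3 → ℂ) (p q p' q' p'' q'' : ℂ) :
    det₃ (p • u + q • v) (p' • u + q' • v) (p'' • u + q'' • v) = 0 := by
  simp [det₃]; ring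

theorem det₃_comb₃ (u v w : Fin 3 → ℂ) (p q r p' q' r' p'' q'' r'' : ℂ) :
    det₃ (p • u + q • v + r • w) (p' • u + q' • v + r' • w) (p'' • u + q'' • v + r'' • w) =
      det₃ ![p, q, r] ![p', q', r'] ![p'', q'', r''] * det₃ u v w := by
  simp [det₃]; ring

/-- Only two generators of `F7` are nonzero, so any three derived elements are dependent. -/
theorem not_degen_F18_F7 : ¬ Degen (Label.gens .F18) (Label.gens .F7) :=
  not_degen₃ (m := 3) {f | det₃ ![f 0 0, f 0 3, f 0 4] ![f 1 0, f 1 3, f 1 4]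
      ![f 2 0, f 2 3, f 2 4] = 0}
    (isClosed_eq (by unfold det₃; fun_prop) (by fun_prop)) (by simp [Label.gens, det₃])
    fun R A f hf => by
      convert det₃_comb₂ ![R.pull ![1, 0, 0, 0, 1] 0, R.pull ![1, 0, 0, 0, 1] 3,
        R.pull ![1, 0, 0, 0, 1] 4] ![R.pull ![0, 0, 1, 1, 0] 0, R.pull ![0, 0, 1, 1, 0] 3,
        R.pull ![0, 0, 1, 1, 0] 4] (A 0 0) (A 0 1) (A 1 0) (A 1 1) (A 2 0) (A 2 1) using 2
      all_goals simp [hf, vec_zero]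

/-- The quadratic parts derived from `G3` span at most a plane of forms. -/
theorem not_degen_F4_G3 : ¬ Degen (Label.gens .F4) (Label.gens .G3) :=
  not_degen₄ (m := 3) {f | det₃ ![f 0 0, f 0 1, f 0 2] ![f 1 0, f 1 1, f 1 2]
      ![f 2 0, f 2 1, f 2 2] = 0}
    (isClosed_eq (by unfold det₃; fun_prop) (by fun_prop)) (by simp [Label.gens, det₃])
    fun R A f hf => by
      convert det₃_comb₂ ![R.pull ![1, 0, 0, 0, 0] 0, R.pull ![1, 0, 0, 0, 0] 1,
        R.pull ![1, 0, 0, 0, 0] 2] ![R.pull ![0, 0, 1, 0, 0] 0, R.pull ![0, 0, 1, 0, 0] 1,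
        R.pull ![0, 0, 1, 0, 0] 2] (A 0 0) (A 0 1) (A 1 0) (A 1 1) (A 2 0) (A 2 1) using 2
      all_goals simp [hf, Chart.pull_vec]

/-! ### The covariant binary cubic of a triple. -/

/-- The derivative of `f` in the direction `w`, an affine function. -/
def dir (w : Fin 2 → ℂ) : Cls →ₗ[ℂ] (Fin 3 → ℂ) where
  toFun f := ![2 * f 0 * w 0 + f 1 * w 1, f 1 * w 0 + 2 * f 2 * w 1, f 3 * w 0 + f 4 * w 1]
  map_add' f g := by ext i; fin_cases i <;> simp <;> ring
  map_smul' c f := by ext i; fin_cases i <;> simp <;> ring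

theorem dir_apply (w : Fin 2 → ℂ) (f : Cls) : dir w f =
    ![2 * f 0 * w 0 + f 1 * w 1, f 1 * w 0 + 2 * f 2 * w 1, f 3 * w 0 + f 4 * w 1] := rfl

theorem dir_smul (c : ℂ) (w : Fin 2 → ℂ) (f : Cls) : dir (c • w) f = c • dir w f := by
  ext i; fin_cases i <;> simp [dir_apply] <;> ring

/-- The cubic form attached to a triple: the determinant of the derivatives. -/
def cubic (f : Fin 3 → Cls) (p q : ℂ) : ℂ :=
  det₃ (dir ![p, q] (f 0)) (dir ![p, q] (f 1)) (dir ![p, q] (f 2))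

theorem continuous_cubic (p q : ℂ) : Continuous fun f => cubic f p q := by
  simp only [cubic, det₃, dir_apply, Matrix.cons_val]
  fun_prop

/-- Taking combinations multiplies the cubic by the determinant of the coefficient matrix, so the
root pattern of the cubic is controlled by the generators alone. -/
theorem cubic_eq {f : Fin 3 → Cls} {u₀ u₁ u₂ : Cls} (R : Chart) (A : Fin 3 → Fin 3 → ℂ)
    (hf : ∀ i, f i = A i 0 • R.pull u₀ + A i 1 • R.pull u₁ + A i 2 • R.pull u₂) (p q : ℂ) :
    cubic f p q = det₃ ![A 0 0, A 0 1, A 0 2] ![A 1 0, A 1 1, A 1 2] ![A 2 0, A 2 1, A 2 2] *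
      cubic ![R.pull u₀, R.pull u₁, R.pull u₂] p q := by
  simp only [cubic, hf, map_add, map_smul, det₃_comb₃, Matrix.cons_val]

/-- The coefficients of the cubic form. -/
noncomputable def cubicCoeff (f : Fin 3 → Cls) : Fin 4 → ℂ :=
  -- The outer coefficients are the values at `(1, 0)` and `(0, 1)`; the odd and even parts of the
  -- values at `(1, ±1)` give the inner ones.
  ![cubic f 1 0, (cubic f 1 1 - cubic f 1 (-1)) / 2 - cubic f 0 1,
    (cubic f 1 1 + cubic f 1 (-1)) / 2 - cubic f 1 0, cubic f 0 1]

theorem continuous_cubicCoeff : Continuous cubicCoeff := by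
  have h := continuous_cubic
  refine continuous_pi fun i => ?_
  fin_cases i
  exacts [h 1 0, (((h 1 1).sub (h 1 (-1))).div_const 2).sub (h 0 1),
    (((h 1 1).add (h 1 (-1))).div_const 2).sub (h 1 0), h 0 1]

theorem cubic_F2 (R : Chart) (p q : ℂ) :
    cubic ![R.pull ![1, 0, 0, 0, 1], R.pull ![0, 0, 1, 1, 0], R.pull ![0, 1, 0, 1 / 2, 1 / 2]] p q =
      -2 * (R.a * R.e - R.b * R.d) * (R.a * p + R.b * q + (R.d * p + R.e * q)) *
        (R.a * p + R.b * q - (R.d * p + R.e * q)) ^ 2 := by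
  simp [cubic, det₃, dir_apply, Chart.pull_vec]
  ring

/-- The cubic of `F2` has a double linear factor, so the discriminant vanishes throughout; the cubic
of `F5` is `4pq(p + q)`, with three distinct roots. -/
theorem not_degen_F5_F2 : ¬ Degen (Label.gens .F5) (Label.gens .F2) :=
  not_degen₃ (m := 3) (cubicCoeff ⁻¹' {c | c 1 ^ 2 * c 2 ^ 2 - 4 * c 0 * c 2 ^ 3 - 4 * c 1 ^ 3 * c 3
      - 27 * c 0 ^ 2 * c 3 ^ 2 + 18 * c 0 * c 1 * c 2 * c 3 = 0})
    ((isClosed_eq (by fun_prop) (by fun_prop)).preimage continuous_cubicCoeff)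
    (by simp [Label.gens, cubicCoeff, cubic, det₃, dir_apply])
    fun R A f hf => by
      simp only [mem_preimage, mem_ofPred_eq, cubicCoeff, cubic_eq R A hf, cubic_F2,
        Matrix.cons_val]
      generalize det₃ _ _ _ = D
      generalize R.a * R.e - R.b * R.d = E
      ring

theorem cubic_F3 (R : Chart) (p q : ℂ) :
    cubic ![R.pull ![1, 0, 0, 0, 0], R.pull ![0, 0, 1, 1, 0], R.pull ![0, 1, 0, 0, 0]] p q =
      -2 * (R.a * R.e - R.b * R.d) * (R.a * p + R.b * q) ^ 3 := by
  simp [cubic, det₃, dir_apply, Chart.pull_vec]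
  ring

/-- The cubic is a multiple of the cube of a linear form. The cubics of `F8` and `F11` are `2p²q`
and `4pq²`, and each violates one of the two relations. -/
theorem cubicCoeff_F3 {f : Fin 3 → Cls} (R : Chart) (A : Fin 3 → Fin 3 → ℂ)
    (hf : ∀ i, f i = A i 0 • R.pull ![1, 0, 0, 0, 0] + A i 1 • R.pull ![0, 0, 1, 1, 0] +
      A i 2 • R.pull ![0, 1, 0, 0, 0]) :
    cubicCoeff f 1 ^ 2 = 3 * cubicCoeff f 0 * cubicCoeff f 2 ∧
      cubicCoeff f 2 ^ 2 = 3 * cubicCoeff f 1 * cubicCoeff f 3 := by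
  simp only [cubicCoeff, cubic_eq R A hf, cubic_F3, Matrix.cons_val]
  generalize det₃ _ _ _ = D
  generalize R.a * R.e - R.b * R.d = E
  constructor <;> ring

theorem not_degen_F8_F3 : ¬ Degen (Label.gens .F8) (Label.gens .F3) :=
  not_degen₃ (m := 3) (cubicCoeff ⁻¹' {c | c 1 ^ 2 = 3 * c 0 * c 2})
    ((isClosed_eq (by fun_prop) (by fun_prop)).preimage continuous_cubicCoeff)
    (by simp [Label.gens, cubicCoeff, cubic, det₃, dir_apply])
    fun R A f hf => (cubicCoeff_F3 R A hf).1

theorem not_degen_F11_F3 : ¬ Degen (Label.gens .F11) (Label.gens .F3) :=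
  not_degen₃ (m := 3) (cubicCoeff ⁻¹' {c | c 2 ^ 2 = 3 * c 1 * c 3})
    ((isClosed_eq (by fun_prop) (by fun_prop)).preimage continuous_cubicCoeff)
    (by simp [Label.gens, cubicCoeff, cubic, det₃, dir_apply])
    fun R A f hf => (cubicCoeff_F3 R A hf).2

end QuadOrbits

/-! ### Obstructions by dimension, by special directions and by critical points. -/

namespace QuadOrbits

open Set Filter Topology

theorem not_linearIndependent_of_comb {m k : ℕ} (hk : k < m) {f : Fin m → Cls} (u : Fin k → Cls)
    (A : Fin m → Fin k → ℂ) (hf : ∀ i, f i = ∑ j, A i j • u j) : ¬ LinearIndependent ℂ f := by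
  intro h
  have hle : Submodule.span ℂ (range f) ≤ Submodule.span ℂ (range u) := by
    rw [Submodule.span_le]
    rintro _ ⟨i, rfl⟩
    rw [hf]
    exact Submodule.sum_mem _ fun j _ => Submodule.smul_mem _ _ (Submodule.subset_span ⟨j, rfl⟩)
  have h1 := Submodule.finrank_mono hle
  rw [finrank_span_eq_card h] at h1
  have h2 := finrank_range_le_card (R := ℂ) u
  simp only [Fintype.card_fin, Set.finrank] at h1 h2
  omega

/-- Linear independence is an open condition, so a limit of tuples spanning spaces of dimension at
most `k` is still dependent. -/
theorem not_degen_of_linearIndependent {m k : ℕ} (hk : k < m) {v : Fin m → Cls} (u : Fin k → Cls)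
    (hv : LinearIndependent ℂ v) : ¬ Degen v u :=
  not_degen_of_isClosed {f | ¬ LinearIndependent ℂ f}
    isOpen_setOfPred_linearIndependent.isClosed_compl
    (fun h => h hv) fun R A _ hf => not_linearIndependent_of_comb hk (fun j => R.pull (u j)) A hf

theorem forall_fin_four {p : Fin 4 → Prop} (h0 : p 0) (h1 : p 1) (h2 : p 2) (h3 : p 3) (i : Fin 4) :
    p i := by
  fin_cases i <;> assumption

theorem linearIndependent_gens (a : Label) (ha : 3 < a.dim) : LinearIndependent ℂ a.gens := by
  rw [Fintype.linearIndependent_iff]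
  cases a <;> simp only [Label.dim, lt_irrefl] at ha <;> intro g hg
  · replace hg : ∑ i : Fin 5, g i • Label.gens .G0 i = 0 := hg
    simp [Fin.sum_univ_succ, Label.gens] at hg
    exact Fin.forall_fin_succ.2 ⟨hg.1, by simpa [Fin.forall_fin_succ] using hg.2⟩
  · replace hg : ∑ i : Fin 4, g i • Label.gens .G1 i = 0 := hg
    simp [Fin.sum_univ_succ, Label.gens] at hg
    exact forall_fin_four hg.1 hg.2.2.1 hg.2.1 hg.2.2.2.1
  · replace hg : ∑ i : Fin 4, g i • Label.gens .G2 i = 0 := hg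
    simp [Fin.sum_univ_succ, Label.gens] at hg
    exact forall_fin_four hg.1 hg.2.2.1 hg.2.1 hg.2.2.2
  · replace hg : ∑ i : Fin 4, g i • Label.gens .G3 i = 0 := hg
    simp [Fin.sum_univ_succ, Label.gens] at hg
    exact forall_fin_four hg.1 hg.2.1 hg.2.2.1 hg.2.2.2
  · replace hg : ∑ i : Fin 4, g i • Label.gens .G4 i = 0 := hg
    simp [Fin.sum_univ_succ, Label.gens] at hg
    exact forall_fin_four hg.1 hg.2.1 hg.2.2.1 hg.2.2.2

theorem not_degen_G0_G1 : ¬ Degen (Label.gens .G0) (Label.gens .G1) :=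
  not_degen_of_linearIndependent (by decide) _ (linearIndependent_gens _ (by decide))

theorem not_degen_G4_F1 : ¬ Degen (Label.gens .G4) (Label.gens .F1) :=
  not_degen_of_linearIndependent (by decide) _ (linearIndependent_gens _ (by decide))

/-- By homogeneity the witness can be taken on the unit sphere, which is compact, and projection
along a compact factor is a closed map. -/
theorem isClosed_exists_ne_zero {ι E : Type*} [Fintype ι] [TopologicalSpace E]
    {C : (ι → ℂ) → E → Prop} (hC : IsClosed {p : (ι → ℂ) × E | C p.1 p.2})
    (hom : ∀ (c : ℂ) w f, c ≠ 0 → C w f → C (c • w) f) :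
    IsClosed {f | ∃ w : ι → ℂ, w ≠ 0 ∧ C w f} := by
  have hK : CompactSpace (Metric.sphere (0 : ι → ℂ) 1) := inferInstance
  have h : {f | ∃ w : ι → ℂ, w ≠ 0 ∧ C w f} =
      Prod.snd '' {p : Metric.sphere (0 : ι → ℂ) 1 × E | C p.1 p.2} := by
    ext f
    constructor
    · rintro ⟨w, hw, h⟩
      have hn : ‖w‖ ≠ 0 := norm_ne_zero_iff.2 hw
      refine ⟨(⟨(‖w‖⁻¹ : ℂ) • w, ?_⟩, f), hom _ w f (by simpa using hw) h, rfl⟩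
      simp [norm_smul, hn]
    · rintro ⟨⟨⟨w, hw⟩, f⟩, h, rfl⟩
      refine ⟨w, ?_, h⟩
      rintro rfl
      simp at hw
  rw [h]
  have hc : Continuous fun p : Metric.sphere (0 : ι → ℂ) 1 × E =>
      ((p.1 : ι → ℂ), p.2) := by fun_prop
  exact isClosedMap_snd_of_compactSpace _ (hC.preimage hc)

theorem det₃_smul (c : ℂ) (x y z : Fin 3 → ℂ) :
    det₃ (c • x) (c • y) (c • z) = c ^ 3 * det₃ x y z := by
  simp [det₃]; ring

/-- The direction on which the linear part of the first coordinate vanishes. -/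
def Chart.kerX (R : Chart) : Fin 2 → ℂ := ![R.b, -R.a]

/-- The direction on which the linear part of the second coordinate vanishes. -/
def Chart.kerY (R : Chart) : Fin 2 → ℂ := ![R.e, -R.d]

theorem Chart.kerX_ne_zero (R : Chart) : R.kerX ≠ 0 := fun h => R.det_ne (by
  have h0 : R.b = 0 := congrFun h 0
  have h1 : R.a = 0 := by simpa [kerX] using congrFun h 1
  simp [h0, h1])

theorem Chart.kerY_ne_zero (R : Chart) : R.kerY ≠ 0 := fun h => R.det_ne (by
  have h0 : R.e = 0 := congrFun h 0
  have h1 : R.d = 0 := by simpa [kerY] using congrFun h 1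
  simp [h0, h1])

/-- The value of the quadratic part of `f` at `w`. -/
def quadAt (w : Fin 2 → ℂ) (f : Cls) : ℂ := f 0 * w 0 ^ 2 + f 1 * (w 0 * w 1) + f 2 * w 1 ^ 2

theorem quadAt_smul (c : ℂ) (w : Fin 2 → ℂ) (f : Cls) :
    quadAt (c • w) f = c ^ 2 * quadAt w f := by
  simp [quadAt]; ring

theorem vec₂_eq_zero {w : Fin 2 → ℂ} (h0 : w 0 = 0) (h1 : w 1 = 0) : w = 0 := by
  ext i; fin_cases i <;> assumption

/-- All quadratic parts derived from `x², xy, x, y` vanish in the direction `x = 0`, while `x²` and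
`y²` have no common nonzero root. -/
theorem not_degen_F13_G4 : ¬ Degen (Label.gens .F13) (Label.gens .G4) :=
  not_degen₄ (m := 3) {f | ∃ w : Fin 2 → ℂ, w ≠ 0 ∧ quadAt w (f 0) = 0 ∧ quadAt w (f 1) = 0}
    (isClosed_exists_ne_zero ((isClosed_eq (by unfold quadAt; fun_prop) (by fun_prop)).inter
      (isClosed_eq (by unfold quadAt; fun_prop) (by fun_prop)))
      fun c w f hc h => by simp [quadAt_smul, h.1, h.2])
    (by
      rintro ⟨w, hw, h0, h1⟩
      simp [quadAt, Label.gens] at h0 h1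
      exact hw (vec₂_eq_zero h0 h1))
    fun R A f hf => ⟨R.kerX, R.kerX_ne_zero, by
      constructor <;> (simp [hf, quadAt, Chart.kerX, Chart.pull_vec]; ring)⟩

/-- The derivative along the direction `x = 0` kills the generators `x²` and `x` of `G2`, so the
derivatives of all combinations lie in a plane and every three are dependent. For `G1` the two
determinants are `2w₀³` and `-2w₁³`. -/
theorem not_degen_G1_G2 : ¬ Degen (Label.gens .G1) (Label.gens .G2) :=
  not_degen₄ (m := 4) {f | ∃ w : Fin 2 → ℂ, w ≠ 0 ∧
      det₃ (dir w (f 0)) (dir w (f 2)) (dir w (f 3)) = 0 ∧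
      det₃ (dir w (f 0)) (dir w (f 1)) (dir w (f 2)) = 0}
    (isClosed_exists_ne_zero
      ((isClosed_eq (by simp only [det₃, dir_apply, Matrix.cons_val]; fun_prop)
      (by fun_prop)).inter
      (isClosed_eq (by simp only [det₃, dir_apply, Matrix.cons_val]; fun_prop) (by fun_prop)))
      fun c w f hc h => by
        simp [dir_smul, det₃_smul, h.1, h.2])
    (by
      rintro ⟨w, hw, h0, h1⟩
      simp [dir_apply, det₃, Label.gens] at h0 h1
      exact hw (vec₂_eq_zero h0 h1))
    fun R A f hf => ⟨R.kerX, R.kerX_ne_zero, by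
      have h0 : dir R.kerX (R.pull ![1, 0, 0, 0, 0]) = 0 := by
        simp [dir_apply, Chart.kerX, Chart.pull_vec]; ring_nf; simp
      have h1 : dir R.kerX (R.pull ![0, 0, 0, 1, 0]) = 0 := by
        simp [dir_apply, Chart.kerX, Chart.pull_vec]; ring
      simp only [hf, map_add, map_smul, h0, h1, smul_zero, zero_add, add_zero, det₃_comb₂]
      trivial⟩

/-- A two-by-two minor of the matrix with rows `x`, `y`. -/
def minor (k l : Fin 3) (x y : Fin 3 → ℂ) : ℂ := x k * y l - x l * y k

theorem minor_smul (k l : Fin 3) (c : ℂ) (x y : Fin 3 → ℂ) :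
    minor k l (c • x) (c • y) = c ^ 2 * minor k l x y := by
  simp [minor]; ring

theorem minor_smul_smul (k l : Fin 3) (p q : ℂ) (x : Fin 3 → ℂ) :
    minor k l (p • x) (q • x) = 0 := by
  simp [minor]; ring

theorem continuous_minor_dir {m : ℕ} (k l : Fin 3) (i j : Fin m) :
    Continuous fun p : (Fin 2 → ℂ) × (Fin m → Cls) =>
      minor k l (dir p.1 (p.2 i)) (dir p.1 (p.2 j)) := by
  have h (s : Fin m) (r : Fin 3) :
      Continuous fun p : (Fin 2 → ℂ) × (Fin m → Cls) => dir p.1 (p.2 s) r := by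
    fin_cases r <;> simp only [dir_apply] <;> dsimp <;> fun_prop
  exact ((h i k).mul (h j l)).sub ((h i l).mul (h j k))

/-- Along the direction `y = 0` the generators `y²` and `y` have zero derivative, so all derivatives
are multiples of one affine function. Neither `F10` nor `F17` admits such a direction. -/
theorem dir_F11 {m : ℕ} {f : Fin m → Cls} (R : Chart) (A : Fin m → Fin 3 → ℂ)
    (hf : ∀ i, f i = A i 0 • R.pull ![1, 0, 0, 0, 0] + A i 1 • R.pull ![0, 0, 1, 0, 0] +
      A i 2 • R.pull ![0, 0, 0, 0, 1]) (i : Fin m) :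
    dir R.kerY (f i) = A i 0 • dir R.kerY (R.pull ![1, 0, 0, 0, 0]) := by
  have h0 : dir R.kerY (R.pull ![0, 0, 1, 0, 0]) = 0 := by
    simp [dir_apply, Chart.kerY, Chart.pull_vec]; ring_nf; simp
  have h1 : dir R.kerY (R.pull ![0, 0, 0, 0, 1]) = 0 := by
    simp [dir_apply, Chart.kerY, Chart.pull_vec]; ring
  simp [hf, h0, h1]

theorem not_degen_F10_F11 : ¬ Degen (Label.gens .F10) (Label.gens .F11) :=
  not_degen₃ (m := 3) {f | ∃ w : Fin 2 → ℂ, w ≠ 0 ∧ minor 0 1 (dir w (f 0)) (dir w (f 1)) = 0 ∧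
      minor 0 2 (dir w (f 0)) (dir w (f 1)) = 0}
    (isClosed_exists_ne_zero ((isClosed_eq (continuous_minor_dir _ _ _ _) continuous_const).inter
      (isClosed_eq (continuous_minor_dir _ _ _ _) continuous_const))
      fun c w f hc h => by simp [dir_smul, minor_smul, h.1, h.2])
    (by
      rintro ⟨w, hw, h0, h1⟩
      simp [dir_apply, minor, Label.gens] at h0 h1
      exact hw (vec₂_eq_zero h0 h1))
    fun R A f hf => ⟨R.kerY, R.kerY_ne_zero, by
      simp only [dir_F11 R A hf, minor_smul_smul, and_self]⟩

theorem not_degen_F17_F11 : ¬ Degen (Label.gens .F17) (Label.gens .F11) :=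
  not_degen₃ (m := 3) {f | ∃ w : Fin 2 → ℂ, w ≠ 0 ∧ minor 1 2 (dir w (f 0)) (dir w (f 1)) = 0 ∧
      minor 0 2 (dir w (f 0)) (dir w (f 2)) = 0}
    (isClosed_exists_ne_zero ((isClosed_eq (continuous_minor_dir _ _ _ _) continuous_const).inter
      (isClosed_eq (continuous_minor_dir _ _ _ _) continuous_const))
      fun c w f hc h => by simp [dir_smul, minor_smul, h.1, h.2])
    (by
      rintro ⟨w, hw, h0, h1⟩
      simp [dir_apply, minor, Label.gens] at h0 h1
      exact hw (vec₂_eq_zero h0 h1))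
    fun R A f hf => ⟨R.kerY, R.kerY_ne_zero, by
      simp only [dir_F11 R A hf, minor_smul_smul, and_self]⟩

/-- Along `x = 0` only `xy` among the generators of `F14` has a nonzero derivative, so derivatives
of combinations are proportional; in addition all quadratic parts vanish there. For `F19` the two
requirements are incompatible. -/
theorem not_degen_F19_F14 : ¬ Degen (Label.gens .F19) (Label.gens .F14) :=
  not_degen₃ (m := 3) {f | ∃ w : Fin 2 → ℂ, w ≠ 0 ∧ (minor 0 2 (dir w (f 0)) (dir w (f 1)) = 0 ∧
      minor 1 2 (dir w (f 0)) (dir w (f 1)) = 0) ∧ quadAt w (f 0) = 0}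
    (isClosed_exists_ne_zero (((isClosed_eq (continuous_minor_dir _ _ _ _) continuous_const).inter
      (isClosed_eq (continuous_minor_dir _ _ _ _) continuous_const)).inter
      (isClosed_eq (by unfold quadAt; fun_prop) (by fun_prop)))
      fun c w f hc h => by simp [dir_smul, minor_smul, quadAt_smul, h.1.1, h.1.2, h.2])
    (by
      rintro ⟨w, hw, ⟨h0, h1⟩, h2⟩
      simp [dir_apply, minor, quadAt, Label.gens] at h0 h1 h2
      have : w 0 = 0 ∧ w 1 = 0 := by grind
      exact hw (vec₂_eq_zero this.1 this.2))
    fun R A f hf => ⟨R.kerX, R.kerX_ne_zero, by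
      have h0 : dir R.kerX (R.pull ![1, 0, 0, 0, 0]) = 0 := by
        simp [dir_apply, Chart.kerX, Chart.pull_vec]; ring_nf; simp
      have h1 : dir R.kerX (R.pull ![0, 0, 0, 1, 0]) = 0 := by
        simp [dir_apply, Chart.kerX, Chart.pull_vec]; ring
      simp only [hf, map_add, map_smul, h0, h1, smul_zero, zero_add, add_zero, minor_smul_smul,
        and_self, true_and]
      simp [quadAt, Chart.kerX, Chart.pull_vec]; ring⟩

/-- The coefficients of `x²` and `xy` and the value at `w` of the linear part. -/
def modKer (w : Fin 2 → ℂ) (f : Cls) : Fin 3 → ℂ := ![f 0, f 1, f 3 * w 0 + f 4 * w 1]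

/-- For the direction `w` given by `x = 0`, `modKer w` annihilates the generator `x` of `F6`,
leaving a space of rank at most two. Also the quadratic part `x²` has zero derivative along `w`, so
the leading parts of the derivatives are all proportional to that of `y²`. -/
theorem not_degen_F8_F6 : ¬ Degen (Label.gens .F8) (Label.gens .F6) :=
  not_degen₃ (m := 3) {f | ∃ w : Fin 2 → ℂ, w ≠ 0 ∧
      det₃ (modKer w (f 0)) (modKer w (f 1)) (modKer w (f 2)) = 0 ∧
      minor 0 1 (dir w (f 0)) (dir w (f 1)) = 0}
    (isClosed_exists_ne_zero ((isClosed_eq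
      (by simp only [det₃, modKer, Matrix.cons_val]; fun_prop) continuous_const).inter
      (isClosed_eq (continuous_minor_dir _ _ _ _) continuous_const))
      fun c w f hc h => by
        refine ⟨?_, by simp [dir_smul, minor_smul, h.2]⟩
        have h1 := h.1
        simp only [det₃, modKer, Matrix.cons_val, Pi.smul_apply, smul_eq_mul] at h1 ⊢
        linear_combination c * h1)
    (by
      rintro ⟨w, hw, h0, h1⟩
      simp [dir_apply, minor, modKer, det₃, Label.gens] at h0 h1
      exact hw (vec₂_eq_zero h1 h0))
    fun R A f hf => ⟨R.kerX, R.kerX_ne_zero, by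
      have h (i : Fin 3) : modKer R.kerX (f i) = A i 0 • modKer R.kerX (R.pull ![1, 0, 0, 0, 1]) +
          A i 1 • modKer R.kerX (R.pull ![0, 0, 1, 0, 0]) := by
        ext k
        fin_cases k <;> simp [modKer, hf, Chart.kerX, Chart.pull_vec]; ring
      refine ⟨by simp only [h, det₃_comb₂], ?_⟩
      simp [hf, minor, dir_apply, Chart.kerX, Chart.pull_vec]; ring⟩

/-- For `w` along `x = 0`, `modKer w` annihilates the generator `x`, leaving multiples of one
vector, and the quadratic part `xy` vanishes at `w`. -/
theorem not_degen_F21_F20 : ¬ Degen (Label.gens .F21) (Label.gens .F20) :=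
  not_degen₃ (m := 3) {f | ∃ w : Fin 2 → ℂ, w ≠ 0 ∧
      minor 0 2 (modKer w (f 0)) (modKer w (f 1)) = 0 ∧ quadAt w (f 0) = 0}
    (isClosed_exists_ne_zero ((isClosed_eq
      (by simp only [minor, modKer, Matrix.cons_val]; fun_prop) continuous_const).inter
      (isClosed_eq (by unfold quadAt; fun_prop) continuous_const))
      fun c w f hc h => by
        refine ⟨?_, by simp [quadAt_smul, h.2]⟩
        have h1 := h.1
        simp only [minor, modKer, Matrix.cons_val, Pi.smul_apply, smul_eq_mul] at h1 ⊢
        linear_combination c * h1)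
    (by
      rintro ⟨w, hw, h0, h1⟩
      simp [minor, modKer, quadAt, Label.gens] at h0 h1
      exact hw (vec₂_eq_zero h1 h0))
    fun R A f hf => ⟨R.kerX, R.kerX_ne_zero, by
      constructor
      · simp [hf, minor, modKer, Chart.kerX, Chart.pull_vec]; ring
      · simp [hf, quadAt, Chart.kerX, Chart.pull_vec]; ring⟩

/-- There is a common critical point, possibly at infinity. -/
theorem not_degen_F20_F4 : ¬ Degen (Label.gens .F20) (Label.gens .F4) :=
  not_degen₃ (m := 3) {f | ∃ w : Fin 3 → ℂ, w ≠ 0 ∧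
      2 * f 0 0 * w 0 + f 0 1 * w 1 + f 0 3 * w 2 = 0 ∧
      2 * f 1 0 * w 0 + f 1 1 * w 1 + f 1 3 * w 2 = 0 ∧
      f 1 1 * w 0 + 2 * f 1 2 * w 1 + f 1 4 * w 2 = 0}
    (isClosed_exists_ne_zero ((isClosed_eq (by fun_prop) continuous_const).inter
      ((isClosed_eq (by fun_prop) continuous_const).inter
      (isClosed_eq (by fun_prop) continuous_const)))
      fun c w f hc h => by
        obtain ⟨h0, h1, h2⟩ := h
        simp only [Pi.smul_apply, smul_eq_mul]
        exact ⟨by linear_combination c * h0, by linear_combination c * h1,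
          by linear_combination c * h2⟩)
    (by
      rintro ⟨w, hw, h0, h1, h2⟩
      simp [Label.gens] at h0 h1 h2
      exact hw (by ext i; fin_cases i <;> assumption))
    -- The cross product of the rows of the substitution: homogeneous coordinates of the point sent
    -- to the origin, where `x²`, `y²` and `xy` are all critical.
    fun R A f hf => ⟨![R.b * R.g - R.c * R.e, R.c * R.d - R.a * R.g, R.a * R.e - R.b * R.d],
      fun h => R.det_ne (congrFun h 2), by
      simp only [hf, Chart.pull_vec, Matrix.smul_cons, Matrix.cons_add_cons, Matrix.smul_empty,
        Matrix.empty_add_empty, smul_eq_mul, Matrix.cons_val]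
      refine ⟨?_, ?_, ?_⟩ <;> ring⟩

end QuadOrbits

/-! ### Combinatorics of the diagram. -/

namespace QuadOrbits

namespace Label

/-- All normal forms, from the top of the diagram to its bottom. -/
def all : List Label :=
  [G0, G1, G2, G3, G4, F1, F2, F3, F4, F5, F6, F7, F8, F9, F10, F11, F12, F13, F14, F15, F16,
   F17, F18, F19, F20, F21, F22, F23, F24, F25, F26, F27, F28, F29]

theorem mem_all (a : Label) : a ∈ all := by cases a <;> decide

/-- The set of the normal forms below a given one, as a binary number whose bits are the positions
in the list of all normal forms. -/
def downMask : Label → ℕ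
  | G0 => 0x3ffffffff
  | G1 => 0x3fffffffe
  | G2 => 0x3fffffffc
  | G3 => 0x3fffffe18
  | G4 => 0x3fffc7010
  | F1 => 0x3ffffffe0
  | F2 => 0x3fffffdc0
  | F3 => 0x3ffff6980
  | F4 => 0x3fe520100
  | F5 => 0x3fffffe00
  | F6 => 0x3ffffec00
  | F7 => 0x3ff9b4800
  | F8 => 0x3fffc7000
  | F9 => 0x3fffc6000
  | F10 => 0x3ff984000
  | F11 => 0x3ffdf8000
  | F12 => 0x3ff9b0000
  | F13 => 0x3fe120000
  | F14 => 0x3ff5c0000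
  | F15 => 0x3ff180000
  | F16 => 0x3fc100000
  | F17 => 0x3ffe00000
  | F18 => 0x3de400000
  | F19 => 0x3ff800000
  | F20 => 0x3fd000000
  | F21 => 0x3de000000
  | F22 => 0x3dc000000
  | F23 => 0x388000000
  | F24 => 0x310000000
  | F25 => 0x3e0000000
  | F26 => 0x3c0000000
  | F27 => 0x380000000
  | F28 => 0x300000000
  | F29 => 0x200000000

/-- The normal form `a` lies below `b` in the diagram. -/
def le (a b : Label) : Bool := b.downMask.testBit (a.ctorIdx)

/-- The height of a normal form over the bottom of the diagram. -/
def height : Label → ℕ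
  | G0 => 14
  | G1 => 13
  | G2 => 12
  | G3 => 11
  | G4 => 10
  | F1 => 11
  | F2 => 10
  | F3 => 9
  | F4 => 7
  | F5 => 10
  | F6 => 9
  | F7 => 8
  | F8 => 9
  | F9 => 8
  | F10 => 7
  | F11 => 8
  | F12 => 7
  | F13 => 6
  | F14 => 7
  | F15 => 6
  | F16 => 5
  | F17 => 7
  | F18 => 6
  | F19 => 6
  | F20 => 5
  | F21 => 5
  | F22 => 4
  | F23 => 3
  | F24 => 2
  | F25 => 4
  | F26 => 3
  | F27 => 2
  | F28 => 1
  | F29 => 0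

/-- Pairs `(a, b)` which generate all pairs with `a` not below `b`. -/
def separating : List (Label × Label) :=
  [(G0, G1), (G1, G2), (G4, F1), (F4, G3), (F5, F2), (F8, F3), (F8, F6), (F10, F11), (F11, F3),
   (F13, G4), (F16, F17), (F17, F11), (F18, F7), (F19, F14), (F20, F4), (F21, F16), (F21, F20),
   (F23, F25), (F24, F23), (F24, F25), (F25, F18), (F26, F23), (F27, F24), (F28, F29)]

end Label

open Label

theorem height_lt {a b : Label} (h : a ∈ below b) : a.height < b.height := by
  have H : ∀ b ∈ all, ∀ a ∈ below b, a.height < b.height := by decide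
  exact H b (mem_all b) a h

/-- A finite check of the masks. With the strict growth of `height` along edges, it turns membership
in a mask into an actual path by induction. -/
theorem le_cases {a b : Label} (h : a.le b = true) : a = b ∨ ∃ c ∈ below b, a.le c = true := by
  have H : ∀ b ∈ all, ∀ a ∈ all, a.le b = true → a = b ∨ ∃ c ∈ below b, a.le c = true := by
    decide +kernel
  exact H b (mem_all b) a (mem_all a) h

/-- A finite check that the 24 basic pairs suffice: every missing relation would, by composition
with paths of the diagram, imply one of them. -/
theorem exists_separating {a b : Label} (h : a.le b = false) :
    ∃ p ∈ separating, p.1.le a = true ∧ b.le p.2 = true := by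
  have H : ∀ b ∈ all, ∀ a ∈ all, a.le b = false →
      ∃ p ∈ separating, p.1.le a = true ∧ b.le p.2 = true := by
    decide +kernel
  exact H b (mem_all b) a (mem_all a) h

theorem risingPath_of_le {a b : Label} (h : a.le b = true) : RisingPath a b := by
  induction hk : b.height using Nat.strong_induction_on generalizing b with
  | _ k ih =>
    obtain rfl | ⟨c, hc, hac⟩ := le_cases h
    · exact .refl
    · exact (ih c.height (hk ▸ height_lt hc) hac rfl).tail hc

theorem RisingPath.height_le {a b : Label} (h : RisingPath a b) : a = b ∨ a.height < b.height := by
  induction h with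
  | refl => exact .inl rfl
  | tail _ hbc ih =>
    have := height_lt hbc
    rcases ih with rfl | ih
    · exact .inr this
    · exact .inr (ih.trans this)

theorem RisingPath.antisymm {a b : Label} (h : RisingPath a b) (h' : RisingPath b a) : a = b := by
  rcases h.height_le with h | h
  · exact h
  · rcases h'.height_le with h' | h'
    · exact h'.symm
    · omega

theorem RisingPath.degen {a b : Label} (h : RisingPath a b) : Degen a.gens b.gens := by
  induction h with
  | refl => exact .refl _
  | tail _ hbc ih => exact ih.trans (degen_of_mem_below hbc)

theorem not_degen_of_mem_separating {p : Label × Label} (h : p ∈ separating) :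
    ¬ Degen p.1.gens p.2.gens := by
  simp only [separating, List.mem_cons, List.not_mem_nil, or_false] at h
  rcases h with rfl | rfl | rfl | rfl | rfl | rfl | rfl | rfl | rfl | rfl | rfl | rfl |
    rfl | rfl | rfl | rfl | rfl | rfl | rfl | rfl | rfl | rfl | rfl | rfl
  exacts [
    not_degen_G0_G1, not_degen_G1_G2, not_degen_G4_F1, not_degen_F4_G3, not_degen_F5_F2,
    not_degen_F8_F3, not_degen_F8_F6, not_degen_F10_F11, not_degen_F11_F3, not_degen_F13_G4,
    not_degen_F16_F17, not_degen_F17_F11, not_degen_F18_F7, not_degen_F19_F14, not_degen_F20_F4,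
    not_degen_F21_F16, not_degen_F21_F20, not_degen_F23_F25, not_degen_F24_F23,
    not_degen_F24_F25, not_degen_F25_F18, not_degen_F26_F23, not_degen_F27_F24, not_degen_F28_F29]

/-- Only two facts about `le` are needed: where it holds there is a path, and where it fails there
is an obstruction. That paths imply `le` is then automatic. -/
theorem degen_gens_iff {a b : Label} : Degen a.gens b.gens ↔ RisingPath a b := by
  refine ⟨fun h => ?_, RisingPath.degen⟩
  cases hab : a.le b with
  | true => exact risingPath_of_le hab
  | false =>
    obtain ⟨p, hp, h1, h2⟩ := exists_separating hab
    exact absurd (((risingPath_of_le h1).degen.trans h).trans (risingPath_of_le h2).degen)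
      (not_degen_of_mem_separating hp)

end QuadOrbits

/-! ### Orbits in terms of spans and substitutions. -/

namespace QuadOrbits

open Set Filter Topology Submodule

/-- Each map splits its source as range times kernel. The ranges agree and the kernels then have the
same dimension, so the splittings can be matched. Injectivity is not needed, which allows dependent
tuples below. -/
theorem exists_equiv_of_range_eq {V W : Type*} [AddCommGroup V] [Module ℂ V] [FiniteDimensional ℂ V]
    [AddCommGroup W] [Module ℂ W] (f g : V →ₗ[ℂ] W)
    (h : LinearMap.range f = LinearMap.range g) : ∃ e : V ≃ₗ[ℂ] V, ∀ x, f x = g (e x) := by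
  have split (f : V →ₗ[ℂ] W) : ∃ e : V ≃ₗ[ℂ] LinearMap.range f × LinearMap.ker f,
      ∀ x, ((e x).1 : W) = f x := by
    obtain ⟨p, hp⟩ := (LinearMap.ker f).exists_isCompl
    refine ⟨LinearMap.equivProdOfSurjectiveOfIsCompl f.rangeRestrict
      ((LinearMap.ker f).projectionOnto p hp)
      f.range_rangeRestrict (range_projectionOnto hp) ?_, fun x => rfl⟩
    rw [LinearMap.ker_rangeRestrict, ker_projectionOnto]
    exact hp
  obtain ⟨ef, hef⟩ := split f
  obtain ⟨eg, heg⟩ := split g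
  have hk : Module.finrank ℂ (LinearMap.ker f) = Module.finrank ℂ (LinearMap.ker g) := by
    have h1 := f.finrank_range_add_finrank_ker
    have h2 := g.finrank_range_add_finrank_ker
    rw [h] at h1
    omega
  let ek := LinearEquiv.ofFinrankEq _ _ hk
  refine ⟨(ef.trans ((LinearEquiv.ofEq _ _ h).prodCongr ek)).trans eg.symm, fun x => ?_⟩
  rw [← heg]
  simp [hef]

/-- Two tuples with the same span differ by an invertible matrix, and conversely. -/
theorem span_range_eq_iff {n : ℕ} (v u : Fin n → Cls) : span ℂ (range v) = span ℂ (range u) ↔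
    ∃ M : Matrix (Fin n) (Fin n) ℂ, IsUnit M.det ∧ ∀ i, v i = ∑ j, M i j • u j := by
  constructor
  · intro h
    obtain ⟨e, he⟩ := exists_equiv_of_range_eq (Fintype.linearCombination ℂ v)
      (Fintype.linearCombination ℂ u) (by simpa [Fintype.range_linearCombination] using h)
    refine ⟨(LinearMap.toMatrix' e.toLinearMap).transpose, ?_, fun i => ?_⟩
    · rw [Matrix.det_transpose, LinearMap.det_toMatrix']
      exact e.isUnit_det'
    · have := he (Pi.single i 1)
      rw [Fintype.linearCombination_apply_single, one_smul] at this
      rw [this, Fintype.linearCombination_apply]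
      simp [LinearMap.toMatrix'_apply]
  · rintro ⟨M, hM, h⟩
    have hle {v u : Fin n → Cls} (M : Matrix (Fin n) (Fin n) ℂ) (h : ∀ i, v i = ∑ j, M i j • u j) :
        span ℂ (range v) ≤ span ℂ (range u) := by
      rw [span_le]
      rintro _ ⟨i, rfl⟩
      rw [h]
      exact sum_mem fun j _ => smul_mem _ _ (subset_span ⟨j, rfl⟩)
    refine le_antisymm (hle M h) (hle M⁻¹ fun i => ?_)
    simp only [h, Finset.smul_sum, smul_smul]
    rw [Finset.sum_comm]
    simp only [← Finset.sum_smul, ← Matrix.mul_apply, Matrix.nonsing_inv_mul M hM, Matrix.one_apply]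
    simp

/-- The value at a point of the representative without constant term. -/
def evalCls (f : Cls) (p : Fin 2 → ℂ) : ℂ :=
  f 0 * p 0 ^ 2 + f 1 * (p 0 * p 1) + f 2 * p 1 ^ 2 + f 3 * p 0 + f 4 * p 1

theorem eval_eq_evalCls (f : QuadPoly) (p : Fin 2 → ℂ) :
    QuadPoly.eval f p = evalCls (cls f) p + f 5 := rfl

/-- The origin gives `k = 0`, and the points `(±1, 0)`, `(0, ±1)`, `(1, 1)` determine the five
coefficients. -/
theorem cls_eq_of_evalCls {f g : Cls} {k : ℂ} (h : ∀ p, evalCls f p = evalCls g p + k) : f = g := by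
  have h0 := h ![0, 0]
  have h1 := h ![1, 0]
  have h2 := h ![-1, 0]
  have h3 := h ![0, 1]
  have h4 := h ![0, -1]
  have h5 := h ![1, 1]
  simp [evalCls] at h0 h1 h2 h3 h4 h5
  subst h0
  ext i
  fin_cases i <;> simp
  · linear_combination (h1 + h2) / 2
  · linear_combination h5 - h1 - h3
  · linear_combination (h3 + h4) / 2
  · linear_combination (h1 - h2) / 2
  · linear_combination (h3 - h4) / 2

/-- The affine transformation of the plane given by a substitution. -/
def Chart.map (R : Chart) (p : Fin 2 → ℂ) : Fin 2 → ℂ :=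
  ![R.a * p 0 + R.b * p 1 + R.c, R.d * p 0 + R.e * p 1 + R.g]

theorem evalCls_map (R : Chart) (f : Cls) (p : Fin 2 → ℂ) :
    evalCls f (R.map p) = evalCls (R.pull f) p + evalCls f ![R.c, R.g] := by
  simp [evalCls, Chart.map, Chart.pull]; ring

theorem evalCls_sum {n : ℕ} (c : Fin n → ℂ) (f : Fin n → Cls) (p : Fin 2 → ℂ) :
    evalCls (∑ j, c j • f j) p = ∑ j, c j * evalCls (f j) p := by
  simp only [evalCls, Finset.sum_apply, Pi.smul_apply, smul_eq_mul, Finset.sum_mul,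
    ← Finset.sum_add_distrib]
  exact Finset.sum_congr rfl fun j _ => by ring

theorem exists_chart (R : (Fin 2 → ℂ) ≃ᵃ[ℂ] (Fin 2 → ℂ)) : ∃ S : Chart, ∀ p, R p = S.map p := by
  let x := R.linear (Pi.single 0 1)
  let y := R.linear (Pi.single 1 1)
  have hR (p : Fin 2 → ℂ) : R p = p 0 • x + p 1 • y + R 0 := by
    have h1 : R p = R.linear p + R 0 := by
      have := R.map_vadd 0 p
      simpa using this
    have h2 : p = p 0 • Pi.single 0 1 + p 1 • Pi.single 1 1 := by
      ext i; fin_cases i <;> simp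
    rw [h1]
    conv_lhs => rw [h2]
    simp [x, y]
  refine ⟨⟨x 0, y 0, R 0 0, x 1, y 1, R 0 1, fun hd => ?_⟩, fun p => ?_⟩
  · have key (p : Fin 2 → ℂ) (hp : p 0 • x + p 1 • y = 0) : p = 0 :=
      R.injective (by rw [hR p, hp, zero_add])
    -- If the determinant vanished, these two vectors would be in the kernel of the linear part.
    -- Injectivity forces `x = 0`, and then the first basis vector is in the kernel as well.
    have h1 := key ![y 1, -x 1] (by
      ext i; fin_cases i
      · simp; linear_combination hd
      · simp; ring)
    have h2 := key ![y 0, -x 0] (by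
      ext i; fin_cases i
      · simp; ring
      · simp; linear_combination -hd)
    have hx0 : x 0 = 0 := by simpa using congrFun h2 1
    have hx1 : x 1 = 0 := by simpa using congrFun h1 1
    have h3 := key ![1, 0] (by ext i; fin_cases i <;> simp [hx0, hx1])
    simpa using congrFun h3 0
  · rw [hR]
    ext i; fin_cases i <;> simp [Chart.map] <;> ring

theorem Chart.map_map (R S : Chart) (p : Fin 2 → ℂ) : R.map (S.map p) = (R.comp S).map p := by
  ext i; fin_cases i <;> simp [map, comp] <;> ring

theorem Chart.map_one (p : Fin 2 → ℂ) : one.map p = p := by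
  ext i; fin_cases i <;> simp [map, one]

/-- The affine equivalence given by a substitution. -/
noncomputable def Chart.toAffineEquiv (R : Chart) : (Fin 2 → ℂ) ≃ᵃ[ℂ] (Fin 2 → ℂ) where
  toFun := R.map
  invFun := R.inv.map
  left_inv p := by rw [map_map, inv_comp, map_one]
  right_inv p := by rw [map_map, comp_inv, map_one]
  linear := LinearEquiv.ofInjectiveEndo
    (Matrix.toLin' !![R.a, R.b; R.d, R.e]) (by
      rw [← LinearMap.ker_eq_bot, LinearMap.ker_eq_bot']
      intro v hv
      have h0 := congrFun hv 0
      have h1 := congrFun hv 1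
      simp [Matrix.mulVec, dotProduct] at h0 h1
      have hd := R.det_ne
      ext i; fin_cases i
      · exact (mul_eq_zero.1 (show (R.a * R.e - R.b * R.d) * v 0 = 0 by
          linear_combination R.e * h0 - R.b * h1)).resolve_left hd
      · exact (mul_eq_zero.1 (show (R.a * R.e - R.b * R.d) * v 1 = 0 by
          linear_combination R.a * h1 - R.d * h0)).resolve_left hd)
  map_vadd' p v := by
    ext i; fin_cases i <;> simp [map, dotProduct] <;> ring

/-- The linear part of `L` is the matrix, and its translation part accounts for all constant terms.
-/
theorem mem_orbit_iff {n : ℕ} (F G : QuadMap n) : F ∈ orbit G ↔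
    ∃ (R : Chart) (M : Matrix (Fin n) (Fin n) ℂ), IsUnit M.det ∧
      ∀ i, cls (F i) = ∑ j, M i j • R.pull (cls (G j)) := by
  constructor
  · rintro ⟨L, R, h⟩
    obtain ⟨S, hS⟩ := exists_chart R
    refine ⟨S, LinearMap.toMatrix' L.linear.toLinearMap, ?_, fun i => ?_⟩
    · rw [LinearMap.det_toMatrix']
      exact L.linear.isUnit_det'
    · have hL (y : Fin n → ℂ) : L y i =
          ∑ j, LinearMap.toMatrix' L.linear.toLinearMap i j * y j + L 0 i := by
        have h1 : L y = L.linear y + L 0 := by simpa using L.map_vadd 0 y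
        rw [h1]
        have h2 := congrFun (LinearMap.toMatrix'_mulVec L.linear.toLinearMap y) i
        simp only [Matrix.mulVec, dotProduct] at h2
        rw [h2]
        rfl
      refine cls_eq_of_evalCls (k := ∑ j, LinearMap.toMatrix' L.linear.toLinearMap i j *
        (evalCls (cls (G j)) ![S.c, S.g] + G j 5) + L 0 i - F i 5) fun p => ?_
      have h1 := congrFun (h p) i
      rw [hL, hS] at h1
      simp only [QuadMap.eval, eval_eq_evalCls, evalCls_map] at h1
      rw [evalCls_sum]
      simp only [mul_add, Finset.sum_add_distrib] at h1 ⊢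
      linear_combination h1
  · rintro ⟨R, M, hM, h⟩
    let E : (Fin n → ℂ) ≃ₗ[ℂ] (Fin n → ℂ) := 
      Matrix.toLinearEquiv' M (M.invertibleOfIsUnitDet hM)
    -- The translation is the difference between the constant term of `F` and the constant produced
    -- by the substitution and the matrix.
    refine ⟨E.toAffineEquiv.trans (AffineEquiv.constVAdd ℂ (Fin n → ℂ) fun i => F i 5 -
      ∑ j, M i j * (evalCls (cls (G j)) ![R.c, R.g] + G j 5)), R.toAffineEquiv, fun p => ?_⟩
    ext i
    have hE (y : Fin n → ℂ) : E y i = ∑ j, M i j * y j := rfl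
    have hp : R.toAffineEquiv p = R.map p := rfl
    simp only [AffineEquiv.trans_apply, LinearEquiv.coe_toAffineEquiv, AffineEquiv.constVAdd_apply,
      vadd_eq_add,
      Pi.add_apply, hE, hp, QuadMap.eval, eval_eq_evalCls, h, evalCls_sum, evalCls_map, mul_add,
      Finset.sum_add_distrib]
    ring

end QuadOrbits

/-! ### Closures of orbits and the degeneration preorder. -/

namespace QuadOrbits

open Set Filter Topology Submodule

/-- The classes of the components of a normal form regarded as a mapping to `ℂⁿ`. -/
noncomputable def Label.pad (n : ℕ) (a : Label) : Fin n → Cls := fun i => cls (extend a.rep n i)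

theorem pad_castLE {n : ℕ} {a : Label} (ha : a.dim ≤ n) (j : Fin a.dim) :
    a.pad n (Fin.castLE ha j) = a.gens j := by
  rw [← cls_rep a]
  simp [Label.pad, extend]

theorem pad_eq_zero {n : ℕ} {a : Label} (ha : a.dim ≤ n) {i : Fin n}
    (hi : i ∉ range (Fin.castLE ha)) : a.pad n i = 0 := by
  have : ¬ (i : ℕ) < a.dim := fun h => hi ⟨⟨i, h⟩, rfl⟩
  simp [Label.pad, extend, this]

theorem sum_smul_pad {n : ℕ} {a : Label} (ha : a.dim ≤ n) (R : Chart) (c : Fin n → ℂ) :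
    ∑ i, c i • R.pull (a.pad n i) = ∑ j, c (Fin.castLE ha j) • R.pull (a.gens j) := by
  symm
  refine Fintype.sum_of_injective (Fin.castLE ha) (Fin.castLE_injective ha) _ _ ?_ ?_
  · intro i hi
    simp [pad_eq_zero ha hi]
  · intro j
    rw [pad_castLE]

/-- The classes of the elements of an orbit. -/
def orb (n : ℕ) (a : Label) : Set (Fin n → Cls) :=
  {f | ∃ (R : Chart) (M : Matrix (Fin n) (Fin n) ℂ), IsUnit M.det ∧
    ∀ i, f i = ∑ j, M i j • R.pull (a.pad n j)}

theorem orb_subset_shadow {n : ℕ} {a : Label} (ha : a.dim ≤ n) : orb n a ⊆ shadow n a.gens := by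
  rintro f ⟨R, M, -, hf⟩
  exact ⟨R, fun i j => M i (Fin.castLE ha j), fun i => by rw [hf, sum_smul_pad ha]⟩

/-- A square coefficient matrix becomes invertible after adding arbitrarily small multiples of the
identity. -/
theorem shadow_subset_closure_orb {n : ℕ} {a : Label} (ha : a.dim ≤ n) :
    shadow n a.gens ⊆ closure (orb n a) := by
  classical
  rintro f ⟨R, A, hf⟩
  -- The coefficients are completed to a square matrix by zero columns, which meet only the zero
  -- components of the padded normal form.
  let A' : Matrix (Fin n) (Fin n) ℂ := fun i j => if h : (j : ℕ) < a.dim then A i ⟨j, h⟩ else 0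
  let Φ : ℂ → Fin n → Cls := fun t i => ∑ j, (A' i j + t * (1 : Matrix (Fin n) (Fin n) ℂ) i j) •
    R.pull (a.pad n j)
  have hΦ : Continuous Φ := by
    refine continuous_pi fun i => continuous_finsetSum _ fun j _ => ?_
    have : Continuous fun t : ℂ => A' i j + t * (1 : Matrix (Fin n) (Fin n) ℂ) i j := by fun_prop
    exact this.smul continuous_const
  have h0 : Φ 0 = f := by
    ext1 i
    simp only [Φ, zero_mul, add_zero, sum_smul_pad ha, hf]
    simp [A']
  -- The determinant of `A' + t • 1` is the value at `t` of the characteristic polynomial of `-A'`.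
  -- This polynomial is monic, so the bad values of `t` are finite in number.
  have hfin : {t | (-A').charpoly.IsRoot t}.Finite :=
    Polynomial.finite_setOfPred_isRoot (Matrix.charpoly_monic _).ne_zero
  have hd := hfin.countable.dense_compl ℂ
  rw [← h0]
  refine map_mem_closure hΦ (hd 0) fun t ht => ⟨R, A' + t • 1, ?_, fun i => by simp [Φ]⟩
  rw [isUnit_iff_ne_zero]
  intro h
  refine ht ?_
  rw [mem_ofPred_eq, Polynomial.IsRoot.def, Matrix.eval_charpoly]
  convert h using 2
  rw [sub_neg_eq_add, add_comm]
  simp [Matrix.smul_one_eq_diagonal]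

/-- Passing to classes modulo constants, in every component. -/
def clsMap (n : ℕ) : QuadMap n →ₗ[ℂ] (Fin n → Cls) := cls.compLeft (Fin n)

theorem orbit_eq_preimage (n : ℕ) (a : Label) : a.orbit n = clsMap n ⁻¹' orb n a := by
  ext F
  exact mem_orbit_iff F _

theorem continuous_clsMap (n : ℕ) : Continuous (clsMap n) :=
  LinearMap.continuous_of_finiteDimensional _

theorem clsMap_surjective (n : ℕ) : Function.Surjective (clsMap n) := by
  intro f
  refine ⟨fun i => ![f i 0, f i 1, f i 2, f i 3, f i 4, 0], ?_⟩
  ext i k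
  fin_cases k <;> rfl

/-- Dropping constant terms is a surjective linear map, hence open as well as continuous, so
preimages commute with closures. -/
theorem closure_orbit (n : ℕ) (a : Label) :
    closure (a.orbit n) = clsMap n ⁻¹' closure (orb n a) := by
  rw [orbit_eq_preimage]
  exact (((clsMap n).isOpenMap_of_finiteDimensional (clsMap_surjective n)
    ).preimage_closure_eq_closure_preimage
    (continuous_clsMap n) _).symm

/-- In one direction the first `a.dim` components are kept, the rest being zero. In the other,
tuples of combinations of `a` are limits of combinations of `b`, which are limits of elements of the
orbit of `b`. -/
theorem orbit_subset_closure_iff {n : ℕ} {a b : Label} (ha : a.dim ≤ n) (hb : b.dim ≤ n) :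
    a.orbit n ⊆ closure (b.orbit n) ↔ Degen a.gens b.gens := by
  rw [closure_orbit]
  constructor
  · intro h
    have h1 : extend a.rep n ∈ a.orbit n := ⟨.refl ℂ _, .refl ℂ _, fun p => rfl⟩
    have h2 : a.pad n ∈ closure (shadow n b.gens) := closure_mono (orb_subset_shadow hb) (h h1)
    let Φ : (Fin n → Cls) → (Fin a.dim → Cls) := fun f j => f (Fin.castLE ha j)
    have hΦ : Continuous Φ := by fun_prop
    have h3 : Φ (a.pad n) = a.gens := funext (pad_castLE ha)
    rw [← h3]
    refine map_mem_closure hΦ h2 ?_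
    rintro f ⟨R, A, hf⟩
    exact ⟨R, fun j => A (Fin.castLE ha j), fun j => hf _⟩
  · intro h F hF
    rw [orbit_eq_preimage] at hF
    exact closure_minimal (shadow_subset_closure_orb hb) isClosed_closure
      (shadow_subset_closure h (orb_subset_shadow ha hF))

theorem map_pull_span {k : ℕ} (R : Chart) (u : Fin k → Cls) :
    (span ℂ (range u)).map R.pull = span ℂ (range fun j => R.pull (u j)) := by
  rw [Submodule.map_span, ← range_comp]
  rfl

theorem span_range_pad {n : ℕ} {a : Label} (ha : a.dim ≤ n) :
    span ℂ (range (a.pad n)) = span ℂ (range a.gens) := by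
  refine le_antisymm (span_le.2 ?_) (span_mono ?_)
  · rintro _ ⟨i, rfl⟩
    by_cases hi : i ∈ range (Fin.castLE ha)
    · obtain ⟨j, rfl⟩ := hi
      rw [pad_castLE]
      exact subset_span ⟨j, rfl⟩
    · rw [pad_eq_zero ha hi]
      exact zero_mem _
  · rintro _ ⟨j, rfl⟩
    exact ⟨_, pad_castLE ha j⟩

theorem mem_orbit_iff_span {n : ℕ} {a : Label} (ha : a.dim ≤ n) (F : QuadMap n) : F ∈ a.orbit n ↔
    ∃ R : Chart, span ℂ (range (clsMap n F)) = (span ℂ (range a.gens)).map R.pull := by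
  rw [orbit_eq_preimage]
  refine exists_congr fun R => ?_
  rw [← span_range_pad ha, map_pull_span, span_range_eq_iff]

theorem Chart.map_inv_pull_map_pull (R : Chart) (W : Submodule ℂ Cls) :
    (W.map R.pull).map R.inv.pull = W := by
  rw [← Submodule.map_comp]
  convert Submodule.map_id W
  exact LinearMap.ext R.inv_pull_pull

theorem Chart.map_pull_comp (R S : Chart) (W : Submodule ℂ Cls) :
    W.map (R.comp S).pull = (W.map R.pull).map S.pull := by
  rw [← Submodule.map_comp]
  congr 1
  exact LinearMap.ext (pull_comp R S)

theorem exists_comb_of_span_eq {m k : ℕ} {v : Fin m → Cls} {u : Fin k → Cls} {R : Chart}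
    (h : span ℂ (range u) = (span ℂ (range v)).map R.pull) :
    ∃ A : Fin m → Fin k → ℂ, ∀ i, v i = ∑ j, A i j • R.inv.pull (u j) := by
  have h1 := congrArg (Submodule.map R.inv.pull) h
  rw [R.map_inv_pull_map_pull, map_pull_span] at h1
  have h2 (i : Fin m) : ∃ c : Fin k → ℂ, ∑ j, c j • R.inv.pull (u j) = v i := by
    rw [← mem_span_range_iff_exists_fun, h1]
    exact subset_span ⟨i, rfl⟩
  choose A hA using h2
  exact ⟨A, fun i => (hA i).symm⟩

theorem degen_of_mem_orbit {n : ℕ} {a b : Label} (ha : a.dim ≤ n) (hb : b.dim ≤ n) {F : QuadMap n}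
    (hFa : F ∈ a.orbit n) (hFb : F ∈ b.orbit n) : Degen a.gens b.gens := by
  obtain ⟨R, hR⟩ := (mem_orbit_iff_span ha F).1 hFa
  obtain ⟨S, hS⟩ := (mem_orbit_iff_span hb F).1 hFb
  have h : span ℂ (range fun j => S.pull (b.gens j)) = (span ℂ (range a.gens)).map R.pull := by
    rw [← map_pull_span, ← hS, hR]
  obtain ⟨A, hA⟩ := exists_comb_of_span_eq h
  exact .of_comb (S.comp R.inv) A fun i => by simpa only [Chart.pull_comp] using hA i

/-- If `a.dim` exceeded `n ≥ 3`, then `a` would be one of the forms in dimension above three. Their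
generators are independent and cannot be combinations of `n` elements. -/
theorem dim_le_of_span_eq {n : ℕ} (hn : 3 ≤ n) {a : Label} {F : QuadMap n} {R : Chart}
    (h : span ℂ (range (clsMap n F)) = (span ℂ (range a.gens)).map R.pull) : a.dim ≤ n := by
  by_contra! hlt
  obtain ⟨A, hA⟩ := exists_comb_of_span_eq h
  exact not_linearIndependent_of_comb hlt _ A hA (linearIndependent_gens a (by omega))

end QuadOrbits

/-! ### Normal forms of subspaces whose quadratic parts do not fill the space of forms. -/

namespace QuadOrbits

open Set Submodule

/-- The subspace is spanned by a normal form after a substitution. -/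
def Classified (W : Submodule ℂ Cls) : Prop :=
  ∃ (a : Label) (R : Chart), W = (span ℂ (range a.gens)).map R.pull

theorem Classified.of_map {W : Submodule ℂ Cls} (R : Chart) (h : Classified (W.map R.pull)) :
    Classified W := by
  obtain ⟨a, S, hS⟩ := h
  refine ⟨a, S.comp R.inv, ?_⟩
  rw [Chart.map_pull_comp, ← hS, Chart.map_inv_pull_map_pull]

theorem Classified.map {W : Submodule ℂ Cls} (R : Chart) (h : Classified W) :
    Classified (W.map R.pull) :=
  .of_map R.inv (by rwa [Chart.map_inv_pull_map_pull])

theorem Classified.gens (a : Label) : Classified (span ℂ (range a.gens)) :=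
  ⟨a, Chart.one, by simp [map_pull_span, Chart.pull_one]⟩

theorem Classified.of_matrix {n : ℕ} {v u : Fin n → Cls} (R : Chart) (A : Matrix (Fin n) (Fin n) ℂ)
    (hd : A.det ≠ 0) (h : ∀ i, v i = ∑ j, A i j • R.pull (u j))
    (hu : Classified (span ℂ (range u))) : Classified (span ℂ (range v)) := by
  rw [(span_range_eq_iff v fun j => R.pull (u j)).2 ⟨A, isUnit_iff_ne_zero.2 hd, h⟩,
    ← map_pull_span]
  exact hu.map R

/-- By default the identities are verified coefficient by coefficient, and the nonvanishing of the
determinant by simplification with the hypotheses in scope. -/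
theorem Classified.of_triple {u₀ u₁ u₂ v₀ v₁ v₂ : Cls} (R : Chart) (A : Fin 3 → Fin 3 → ℂ)
    (hu : Classified (span ℂ (range ![u₀, u₁, u₂])))
    (h : v₀ = A 0 0 • R.pull u₀ + A 0 1 • R.pull u₁ + A 0 2 • R.pull u₂ ∧
      v₁ = A 1 0 • R.pull u₀ + A 1 1 • R.pull u₁ + A 1 2 • R.pull u₂ ∧
      v₂ = A 2 0 • R.pull u₀ + A 2 1 • R.pull u₁ + A 2 2 • R.pull u₂
      := by
        simp only [Chart.pull_vec, Matrix.smul_cons, Matrix.cons_add_cons, Matrix.smul_empty,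
          Matrix.empty_add_empty, smul_eq_mul, Matrix.cons_val]
        refine ⟨vec_ext ?_ ?_ ?_ ?_ ?_, vec_ext ?_ ?_ ?_ ?_ ?_, vec_ext ?_ ?_ ?_ ?_ ?_⟩ <;>
        first
        | ring1
        | (field_simp; ring1)
        | field_simp)
    (hd : det₃ (A 0) (A 1) (A 2) ≠ 0 := by simp [det₃, *]) :
    Classified (span ℂ (range ![v₀, v₁, v₂])) := by
  refine .of_matrix R (Matrix.of A) ?_ (fun i => ?_) hu
  · rw [Matrix.det_fin_three]
    convert hd using 1
    simp only [det₃, Matrix.of_apply]; ring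
  · obtain ⟨h0, h1, h2⟩ := h
    fin_cases i
    · simpa [Fin.sum_univ_succ, add_assoc] using h0
    · simpa [Fin.sum_univ_succ, add_assoc] using h1
    · simpa [Fin.sum_univ_succ, add_assoc] using h2

theorem Chart.exists_row {p q : ℂ} (h : p ≠ 0 ∨ q ≠ 0) : ∃ d e : ℂ, p * e - q * d ≠ 0 := by
  rcases h with h | h
  · exact ⟨0, 1, by simpa⟩
  · exact ⟨-1, 0, by simpa⟩

section Triples

variable (α β γ δ lam mu : ℂ)

theorem classified_zero :
    Classified (span ℂ (range ![![0, 0, 0, 0, 0], ![0, 0, 0, 0, 0], ![0, 0, 0, 0, 0]])) :=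
  .gens .F29

theorem classified_linear (h : α ≠ 0 ∨ β ≠ 0) :
    Classified (span ℂ (range ![![0, 0, 0, α, β], ![0, 0, 0, 0, 0], ![0, 0, 0, 0, 0]])) := by
  obtain ⟨d, e, hd⟩ := Chart.exists_row h
  exact .of_triple ⟨α, β, 0, d, e, 0, hd⟩ ![![1, 0, 0], ![0, 1, 0], ![0, 0, 1]] (.gens .F28)

theorem classified_linear_linear :
    Classified (span ℂ (range ![![0, 0, 0, 1, 0], ![0, 0, 0, 0, 1], ![0, 0, 0, 0, 0]])) :=
  .gens .F24

theorem classified_xy :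
    Classified (span ℂ (range ![![0, 1, 0, α, β], ![0, 0, 0, 0, 0], ![0, 0, 0, 0, 0]])) :=
  .of_triple ⟨1, 0, β, 0, 1, α, by simp⟩ ![![1, 0, 0], ![0, 1, 0], ![0, 0, 1]] (.gens .F25)

theorem classified_xy_linear (h : lam ≠ 0 ∨ mu ≠ 0) :
    Classified (span ℂ (range ![![0, 1, 0, α, β], ![0, 0, 0, lam, mu], ![0, 0, 0, 0, 0]])) := by
  by_cases hl : lam = 0
  · have hm : mu ≠ 0 := by simpa [hl] using h
    subst hl
    exact .of_triple ⟨0, 1, α, 1, 0, β, by simp⟩ ![![0, 1, 0], ![mu, 0, 0], ![0, 0, 1]] (.gens .F20)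
  by_cases hm : mu = 0
  · subst hm
    exact .of_triple ⟨1, 0, β, 0, 1, α, by simp⟩ ![![0, 1, 0], ![lam, 0, 0], ![0, 0, 1]]
      (.gens .F20)
  exact .of_triple ⟨lam, 0, lam * β, 0, mu, mu * α, by simp [hl, hm]⟩
    ![![1 / (lam * mu), 0, 0], ![0, 1, 0], ![0, 0, 1]] (.gens .F19)

theorem classified_xy_linear_linear :
    Classified (span ℂ (range ![![0, 1, 0, α, β], ![0, 0, 0, 1, 0], ![0, 0, 0, 0, 1]])) :=
  .of_triple Chart.one ![![1, α, β], ![0, 1, 0], ![0, 0, 1]] (.gens .F17) (by simp [Chart.pull_one])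

theorem classified_xx :
    Classified (span ℂ (range ![![1, 0, 0, α, β], ![0, 0, 0, 0, 0], ![0, 0, 0, 0, 0]])) := by
  by_cases hb : β = 0
  · subst hb
    exact .of_triple ⟨1, 0, α / 2, 0, 1, 0, by simp⟩ ![![1, 0, 0], ![0, 1, 0], ![0, 0, 1]]
      (.gens .F27)
  · exact .of_triple ⟨1, 0, 0, α, β, 0, by simpa⟩ ![![1, 0, 0], ![0, 1, 0], ![0, 0, 1]]
      (.gens .F26)

theorem classified_xx_linear (h : lam ≠ 0 ∨ mu ≠ 0) :
    Classified (span ℂ (range ![![1, 0, 0, α, β], ![0, 0, 0, lam, mu], ![0, 0, 0, 0, 0]])) := by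
  by_cases hm : mu = 0
  · have hl : lam ≠ 0 := by simpa [hm] using h
    subst hm
    by_cases hb : β = 0
    · subst hb
      exact .of_triple Chart.one ![![1, α, 0], ![0, lam, 0], ![0, 0, 1]] (.gens .F23)
        (by simp [Chart.pull_one])
    · exact .of_triple ⟨1, 0, 0, 0, β, 0, by simpa⟩ ![![1, α, 0], ![0, lam, 0], ![0, 0, 1]]
        (.gens .F22)
  · exact .of_triple ⟨1, 0, (α - β * lam / mu) / 2, lam, mu, 0, by simpa⟩
      ![![1, β / mu, 0], ![0, 1, 0], ![0, 0, 1]] (.gens .F21)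

theorem classified_xx_linear_linear :
    Classified (span ℂ (range ![![1, 0, 0, α, β], ![0, 0, 0, 1, 0], ![0, 0, 0, 0, 1]])) :=
  .of_triple Chart.one ![![1, α, β], ![0, 1, 0], ![0, 0, 1]] (.gens .F18) (by simp [Chart.pull_one])

theorem classified_xx_yy :
    Classified (span ℂ (range ![![1, 0, 0, α, β], ![0, 0, 1, γ, δ], ![0, 0, 0, 0, 0]])) := by
  by_cases hb : β = 0
  · subst hb
    by_cases hc : γ = 0
    · subst hc
      exact .of_triple ⟨1, 0, α / 2, 0, 1, δ / 2, by simp⟩ ![![1, 0, 0], ![0, 1, 0], ![0, 0, 1]]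
        (.gens .F13)
    · exact .of_triple ⟨0, 1, δ / 2, γ, 0, γ * α / 2, by simpa⟩
        ![![0, 1 / γ ^ 2, 0], ![1, 0, 0], ![0, 0, 1]] (.gens .F12)
  by_cases hc : γ = 0
  · subst hc
    exact .of_triple ⟨1, 0, α / 2, 0, β, β * δ / 2, by simpa⟩
      ![![1, 0, 0], ![0, 1 / β ^ 2, 0], ![0, 0, 1]] (.gens .F12)
  -- Scaling `x` by `p` and `y` by `q` in `F7` gives linear coefficients `q/p²` and `p/q²`. Matching
  -- them with `β` and `γ` means `q = βp²` and `p³γβ² = 1`.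
  obtain ⟨p, hp⟩ := IsAlgClosed.exists_pow_nat_eq (1 / (γ * β ^ 2)) (n := 3) (by norm_num)
  have hp0 : p ≠ 0 := by
    rintro rfl
    exact absurd hp.symm (by simp [hb, hc])
  have hp' : p ^ 3 * γ * β ^ 2 = 1 := by rw [hp]; field_simp
  refine .of_triple ⟨p, 0, p * α / 2, 0, β * p ^ 2, β * p ^ 2 * δ / 2, by simp [hp0, hb]⟩
    ![![1 / p ^ 2, 0, 0], ![0, 1 / (β ^ 2 * p ^ 4), 0], ![0, 0, 1]] (.gens .F7) ?_
  simp only [Chart.pull_vec, Matrix.smul_cons, Matrix.cons_add_cons, Matrix.smul_empty,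
    Matrix.empty_add_empty, smul_eq_mul, Matrix.cons_val]
  refine ⟨vec_ext ?_ ?_ ?_ ?_ ?_, vec_ext ?_ ?_ ?_ ?_ ?_, vec_ext ?_ ?_ ?_ ?_ ?_⟩ <;>
  first
  | ring1
  | (field_simp; ring1)
  | (field_simp; linear_combination 2 * p * hp')

theorem classified_xx_yy_linear (h : lam ≠ 0 ∨ mu ≠ 0) :
    Classified (span ℂ (range ![![1, 0, 0, α, β], ![0, 0, 1, γ, δ], ![0, 0, 0, lam, mu]])) := by
  by_cases hl : lam = 0
  · have hm : mu ≠ 0 := by simpa [hl] using h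
    subst hl
    by_cases hc : γ = 0
    · subst hc
      exact .of_triple ⟨1, 0, α / 2, 0, 1, 0, by simp⟩ ![![1, 0, β], ![0, 1, δ], ![0, 0, mu]]
        (.gens .F11)
    · exact .of_triple ⟨0, 1, 0, γ, 0, γ * α / 2, by simpa⟩
        ![![0, 1 / γ ^ 2, β], ![1, 0, δ], ![0, 0, mu]] (.gens .F6)
  by_cases hm : mu = 0
  · subst hm
    by_cases hb : β = 0
    · subst hb
      exact .of_triple ⟨0, 1, δ / 2, 1, 0, 0, by simp⟩ ![![0, 1, α], ![1, 0, γ], ![0, 0, lam]]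
        (.gens .F11)
    · exact .of_triple ⟨1, 0, 0, 0, β, β * δ / 2, by simpa⟩
        ![![1, 0, α], ![0, 1 / β ^ 2, γ], ![0, 0, lam]] (.gens .F6)
  exact .of_triple ⟨lam, 0, lam * (α - β / mu * lam) / 2, 0, mu, mu * (δ - γ / lam * mu) / 2,
    by simp [hl, hm]⟩
    ![![1 / lam ^ 2, 0, β / mu], ![0, 1 / mu ^ 2, γ / lam], ![0, 0, 1]] (.gens .F5)

theorem classified_xx_xy :
    Classified (span ℂ (range ![![1, 0, 0, α, β], ![0, 1, 0, γ, δ], ![0, 0, 0, 0, 0]])) := by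
  by_cases hb : β = 0
  · subst hb
    obtain ⟨ε, rfl⟩ : ∃ ε, α = ε + 2 * δ := ⟨α - 2 * δ, by ring⟩
    by_cases he : ε = 0
    · subst he
      exact .of_triple ⟨1, 0, δ, 0, 1, γ, by simp⟩ ![![1, 0, 0], ![0, 1, 0], ![0, 0, 1]]
        (.gens .F16)
    · exact .of_triple ⟨-1 / ε, 0, -δ / ε, 0, 1, γ, by simp [he]⟩
        ![![ε ^ 2, 0, 0], ![0, -ε, 0], ![0, 0, 1]] (.gens .F15)
  -- With `κ` the shear coefficient and `c` the shift of `x`, matching linear terms demands `2c + κ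
  -- = α` and `c - κ = δ`, whence `κ = (α - 2δ)/3`. The shift of `y` then fits `γ`.
  · exact .of_triple ⟨1, 0, (α - 2 * δ) / 3 + δ, (α - 2 * δ) / 3, β,
      γ * β + (α - 2 * δ) / 3 * α - ((α - 2 * δ) / 3 + δ) * ((α - 2 * δ) / 3), by simpa⟩
      ![![1, 0, 0], ![-((α - 2 * δ) / 3) / β, 1 / β, 0], ![0, 0, 1]] (.gens .F10)

theorem classified_xx_xy_linear (h : lam ≠ 0 ∨ mu ≠ 0) :
    Classified (span ℂ (range ![![1, 0, 0, α, β], ![0, 1, 0, γ, δ], ![0, 0, 0, lam, mu]])) := by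
  by_cases hm : mu = 0
  · have hl : lam ≠ 0 := by simpa [hm] using h
    subst hm
    by_cases hb : β = 0
    · subst hb
      exact .of_triple ⟨1, 0, δ, 0, 1, 0, by simp⟩
        ![![1, 0, α - 2 * δ], ![0, 1, γ], ![0, 0, lam]] (.gens .F14)
    · exact .of_triple ⟨1, 0, δ, 0, β, 0, by simpa⟩
        ![![1, 0, α - 2 * δ], ![0, 1 / β, γ], ![0, 0, lam]] (.gens .F9)
  -- The shift `k` of `x` matches the `x` coefficient of the first generator once `β/μ` times the
  -- linear form is added; `c` matches the `y` coefficient of the second.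
  obtain ⟨k, hk⟩ : ∃ k, k = (α - β / mu * lam) / 2 := ⟨_, rfl⟩
  obtain ⟨c, hc⟩ : ∃ c, c = (δ - k) / mu := ⟨_, rfl⟩
  have hα : α = 2 * k + β / mu * lam := by rw [hk]; ring
  have hδ : δ = k + c * mu := by rw [hc]; field_simp; ring
  clear hk hc
  subst hα hδ
  exact .of_triple ⟨1, 0, k, lam, mu, mu * (γ - c * lam) + k * lam, by simpa⟩
    ![![1, 0, β / mu], ![-lam / mu, 1 / mu, c], ![0, 0, 1]] (.gens .F8)

end Triples

end QuadOrbits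

/-! ### Normal forms of subspaces with all quadratic parts present. -/

namespace QuadOrbits

open Set Submodule

section

variable (α β γ δ ε ζ : ℂ)

theorem classified_full_diagonal (hα : α ≠ 0) :
    Classified (span ℂ (range ![![1, 0, 0, α, 0], ![0, 1, 0, 0, 0], ![0, 0, 1, γ, 0]])) := by
  by_cases hc : γ = 0
  · subst hc
    obtain ⟨k, hk, rfl⟩ : ∃ k, k ≠ 0 ∧ α = 4 / k := ⟨4 / α, by simpa, by field_simp⟩
    -- Writing `X, Y` for the new coordinates, `X + Y = kx + 1` and `X - Y = y`. Up to constants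
    -- `F2` then contains `(X + Y)² + 2(X + Y) = k²x² + 4kx`, whence `α = 4/k`, together with `kxy`
    -- and `y²`.
    exact .of_triple ⟨k / 2, 1 / 2, 1 / 2, k / 2, -1 / 2, 1 / 2,
      ne_of_eq_of_ne (b := -k / 2) (by ring) (by simpa)⟩
      ![![1 / k ^ 2, 1 / k ^ 2, 2 / k ^ 2], ![1 / k, -1 / k, 0], ![1, 1, -2]] (.gens .F2)
      (hd := ne_of_eq_of_ne (b := 8 / k ^ 3) (by simp [det₃]; field_simp; ring) (by simpa))
  · obtain ⟨k, hk, rfl⟩ : ∃ k, k ≠ 0 ∧ α = 3 / k := ⟨3 / α, by simpa, by field_simp⟩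
    obtain ⟨l, hl⟩ := IsAlgClosed.exists_pow_nat_eq (k / γ) two_pos
    have hl0 : l ≠ 0 := by
      rintro rfl
      exact absurd hl.symm (by simp [hk, hc])
    obtain rfl : γ = k / l ^ 2 := by rw [hl]; field_simp
    -- Now `X + Y = kx + 1` and `X - Y = ly`. Up to constants `F1` contains `(X + Y)² + (X + Y) =
    -- k²x² + 3kx`, then `klxy`, and `(X - Y)² + (X + Y) = l²y² + kx`.
    exact .of_triple ⟨k / 2, l / 2, 1 / 2, k / 2, -l / 2, 1 / 2,
      ne_of_eq_of_ne (b := -k * l / 2) (by ring) (by simp [hk, hl0])⟩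
      ![![1 / k ^ 2, 1 / k ^ 2, 2 / k ^ 2], ![1 / (k * l), -1 / (k * l), 0],
        ![1 / l ^ 2, 1 / l ^ 2, -2 / l ^ 2]] (.gens .F1)
      (hd := ne_of_eq_of_ne (b := 8 / (k * l) ^ 3) (by simp [det₃]; field_simp; ring)
        (by simp [hk, hl0]))

/-- A shear `y ↦ y + mx` preserves the shape. It removes `β` when `α ≠ 0`, and removes `γ` when `α =
0` and `β ≠ 0`. -/
theorem classified_full_reduced :
    Classified (span ℂ (range ![![1, 0, 0, α, 0], ![0, 1, 0, β, 0], ![0, 0, 1, γ, 0]])) := by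
  by_cases ha : α = 0
  · subst ha
    by_cases hb : β = 0
    · subst hb
      by_cases hc : γ = 0
      · subst hc
        exact .of_triple Chart.one ![![1, 0, 0], ![0, 0, 1], ![0, 1, 0]] (.gens .F4)
          (by simp [Chart.pull_one])
      · exact .of_triple ⟨γ, 0, 0, 0, 1, 0, by simpa⟩
          ![![1 / γ ^ 2, 0, 0], ![0, 0, 1 / γ], ![0, 1, 0]] (.gens .F3)
    · obtain ⟨m, rfl⟩ : ∃ m, γ = -2 * m * β := ⟨-γ / (2 * β), by field_simp⟩
      refine .of_triple (u₀ := ![1, 0, 0, 0, 0]) (u₁ := ![0, 1, 0, β, 0]) (u₂ := ![0, 0, 1, 0, 0])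
        ⟨1, 0, 0, m, 1, 0, by simp⟩ ![![1, 0, 0], ![-m, 1, 0], ![m ^ 2, -2 * m, 1]] ?_
      obtain ⟨k, hk, rfl⟩ : ∃ k, k ≠ 0 ∧ β = -2 / k := ⟨-2 / β, by simpa, by field_simp⟩
      -- Here `X - Y = x` and `X + Y = ky - 1`, so `F2` yields `x²`, `kxy - 2x` and, up to a
      -- constant, `k²y²`.
      exact .of_triple ⟨1 / 2, k / 2, -1 / 2, -1 / 2, k / 2, -1 / 2,
        ne_of_eq_of_ne (b := k / 2) (by ring) (by simpa)⟩
        ![![1, 1, -2], ![1 / k, -1 / k, 0], ![1 / k ^ 2, 1 / k ^ 2, 2 / k ^ 2]] (.gens .F2)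
        (hd := ne_of_eq_of_ne (b := -8 / k ^ 3) (by simp [det₃]; field_simp; ring) (by simpa))
  · obtain ⟨m, rfl⟩ : ∃ m, β = -m * α := ⟨-β / α, by field_simp⟩
    obtain ⟨η, rfl⟩ : ∃ η, γ = η + m ^ 2 * α := ⟨γ - m ^ 2 * α, by ring⟩
    exact .of_triple (u₀ := ![1, 0, 0, α, 0]) (u₁ := ![0, 1, 0, 0, 0]) (u₂ := ![0, 0, 1, η, 0])
      ⟨1, 0, 0, m, 1, 0, by simp⟩ ![![1, 0, 0], ![-m, 1, 0], ![m ^ 2, -2 * m, 1]]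
      (classified_full_diagonal α η ha)

/-- The translation by `(δ, ζ/2)` removes the `y` terms from the generators with quadratic parts
`xy` and `y²`. -/
theorem classified_full :
    Classified (span ℂ (range ![![1, 0, 0, α, 0], ![0, 1, 0, γ, δ], ![0, 0, 1, ε, ζ]])) :=
  .of_triple ⟨1, 0, δ, 0, 1, ζ / 2, by simp⟩ ![![1, 0, 0], ![0, 1, 0], ![0, 0, 1]]
    (classified_full_reduced (α - 2 * δ) (γ - ζ / 2) ε)

theorem classified_full_x : Classified (span ℂ (range ![![1, 0, 0, α, β], ![0, 0, 1, ε, ζ],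
    ![0, 1, 0, γ, δ], ![0, 0, 0, 1, 0]])) := by
  by_cases hb : β = 0
  · subst hb
    refine .of_matrix (n := 4) ⟨1, 0, δ, 0, 1, ζ / 2, by simp⟩
      (Matrix.of ![![1, 0, 0, α - 2 * δ], ![0, 1, 0, ε], ![0, 0, 1, γ - ζ / 2], ![0, 0, 0, 1]])
      ?_ (fun i => ?_) (.gens .G2)
    · simp [Matrix.det_succ_row_zero, Fin.sum_univ_succ]
    · fin_cases i <;> simp [Fin.sum_univ_succ, Label.gens, Chart.pull_vec]
      ring
  · refine .of_matrix (n := 4) ⟨1, 0, δ, 0, β, β * ζ / 2, by simpa⟩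
      (Matrix.of ![![1, 0, 0, α - 2 * δ], ![0, 1 / β ^ 2, 0, ε], ![0, 0, 1 / β, γ - ζ / 2],
        ![0, 0, 0, 1]]) ?_ (fun i => ?_) (.gens .G1)
    · simp [Matrix.det_succ_row_zero, Fin.sum_univ_succ, hb]
    · fin_cases i <;> simp [Fin.sum_univ_succ, Label.gens, Chart.pull_vec] <;> field_simp
      all_goals simp

theorem classified_xx_yy_top : Classified (span ℂ (range ![![1, 0, 0, α, β], ![0, 0, 1, γ, δ],
    ![0, 0, 0, 1, 0], ![0, 0, 0, 0, 1]])) := by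
  refine .of_matrix (n := 4) Chart.one
    (Matrix.of ![![1, 0, α, β], ![0, 1, γ, δ], ![0, 0, 1, 0], ![0, 0, 0, 1]])
    ?_ (fun i => ?_) (.gens .G3)
  · simp [Matrix.det_succ_row_zero, Fin.sum_univ_succ]
  · fin_cases i <;> simp [Fin.sum_univ_succ, Label.gens, Chart.pull_one]

theorem classified_xx_xy_top : Classified (span ℂ (range ![![1, 0, 0, α, β], ![0, 1, 0, γ, δ],
    ![0, 0, 0, 1, 0], ![0, 0, 0, 0, 1]])) := by
  refine .of_matrix (n := 4) Chart.one
    (Matrix.of ![![1, 0, α, β], ![0, 1, γ, δ], ![0, 0, 1, 0], ![0, 0, 0, 1]])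
    ?_ (fun i => ?_) (.gens .G4)
  · simp [Matrix.det_succ_row_zero, Fin.sum_univ_succ]
  · fin_cases i <;> simp [Fin.sum_univ_succ, Label.gens, Chart.pull_one]

theorem classified_top : Classified ⊤ := by
  convert Classified.gens .G0
  refine (eq_top_iff.2 fun f _ => ?_).symm
  refine (mem_span_range_iff_exists_fun (α := Fin 5) ℂ).2 ⟨f, ?_⟩
  ext k
  fin_cases k <;> simp [Fin.sum_univ_succ, Label.gens]

end

end QuadOrbits

/-! ### Spaces of binary quadratic forms. -/

namespace QuadOrbits

open Set Submodule

/-- The degree two part of a quadratic polynomial. -/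
def top : Cls →ₗ[ℂ] (Fin 3 → ℂ) where
  toFun f := ![f 0, f 1, f 2]
  map_add' f g := by ext i; fin_cases i <;> simp
  map_smul' c f := by ext i; fin_cases i <;> simp

theorem top_vec (p q r u v : ℂ) : top ![p, q, r, u, v] = ![p, q, r] := rfl

theorem eq_vec_of_top_eq {f : Cls} {p q r : ℂ} (h : top f = ![p, q, r]) :
    ∃ u v, f = ![p, q, r, u, v] := by
  refine ⟨f 3, f 4, ?_⟩
  have h0 := congrFun h 0
  have h1 := congrFun h 1
  have h2 := congrFun h 2
  ext i; fin_cases i <;> simp_all [top]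

namespace Chart

/-- Substitution into a binary quadratic form. -/
def pullTop (R : Chart) : (Fin 3 → ℂ) →ₗ[ℂ] (Fin 3 → ℂ) where
  toFun f := ![f 0 * R.a ^ 2 + f 1 * (R.a * R.d) + f 2 * R.d ^ 2,
    2 * f 0 * (R.a * R.b) + f 1 * (R.a * R.e + R.b * R.d) + 2 * f 2 * (R.d * R.e),
    f 0 * R.b ^ 2 + f 1 * (R.b * R.e) + f 2 * R.e ^ 2]
  map_add' f g := by ext i; fin_cases i <;> simp <;> ring
  map_smul' c f := by ext i; fin_cases i <;> simp <;> ring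

theorem pullTop_vec (R : Chart) (p q r : ℂ) :
    R.pullTop ![p, q, r] = ![p * R.a ^ 2 + q * (R.a * R.d) + r * R.d ^ 2,
    2 * p * (R.a * R.b) + q * (R.a * R.e + R.b * R.d) + 2 * r * (R.d * R.e),
    p * R.b ^ 2 + q * (R.b * R.e) + r * R.e ^ 2] := rfl

theorem pullTop_comp (R S : Chart) (f : Fin 3 → ℂ) :
    (R.comp S).pullTop f = S.pullTop (R.pullTop f) := by
  ext i; fin_cases i <;> simp [pullTop, comp] <;> ring

theorem pullTop_inv_pullTop (R : Chart) (f : Fin 3 → ℂ) : R.pullTop (R.inv.pullTop f) = f := by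
  rw [← pullTop_comp, inv_comp]
  ext i; fin_cases i <;> simp [pullTop, one]

theorem map_top_map_pull (R : Chart) (W : Submodule ℂ Cls) :
    (W.map R.pull).map top = (W.map top).map R.pullTop := by
  rw [← Submodule.map_comp, ← Submodule.map_comp]
  rfl

theorem map_pullTop_top (R : Chart) : (⊤ : Submodule ℂ (Fin 3 → ℂ)).map R.pullTop = ⊤ :=
  (Submodule.map_top _).trans (LinearMap.range_eq_top.2 fun f => ⟨_, R.pullTop_inv_pullTop f⟩)

end Chart

/-- A space of binary quadratic forms can be brought into a normal form by a substitution. -/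
def TopClassified (Q : Submodule ℂ (Fin 3 → ℂ)) : Prop :=
  ∃ R : Chart, Q.map R.pullTop ∈ ({⊥, span ℂ {![1, 0, 0]}, span ℂ {![0, 1, 0]},
    span ℂ {![1, 0, 0], ![0, 1, 0]}, span ℂ {![1, 0, 0], ![0, 0, 1]}, ⊤} :
      Set (Submodule ℂ (Fin 3 → ℂ)))

theorem TopClassified.of_map {Q : Submodule ℂ (Fin 3 → ℂ)} (R : Chart)
    (h : TopClassified (Q.map R.pullTop)) : TopClassified Q := by
  obtain ⟨S, hS⟩ := h
  refine ⟨R.comp S, ?_⟩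
  rw [← Submodule.map_comp] at hS
  convert hS using 2
  exact LinearMap.ext (R.pullTop_comp S)

theorem TopClassified.of_mem {Q : Submodule ℂ (Fin 3 → ℂ)} (h : Q ∈ ({⊥, span ℂ {![1, 0, 0]},
    span ℂ {![0, 1, 0]}, span ℂ {![1, 0, 0], ![0, 1, 0]}, span ℂ {![1, 0, 0], ![0, 0, 1]}, ⊤} :
      Set (Submodule ℂ (Fin 3 → ℂ)))) : TopClassified Q := by
  refine ⟨Chart.one, ?_⟩
  convert h using 1
  convert Submodule.map_id Q
  ext f i; fin_cases i <;> simp [Chart.pullTop, Chart.one]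

theorem form_eq (f : Fin 3 → ℂ) :
    f = f 0 • ![1, 0, 0] + f 1 • ![0, 1, 0] + f 2 • ![0, 0, 1] := by
  ext i; fin_cases i <;> simp

/-- If some form in `Q` involves `y²`, completing the square with a shear that fixes `x²` puts `y²`
into `Q`. Otherwise `Q` lies in the span of `x²` and `xy`. -/
theorem topClassified_of_xx_mem {Q : Submodule ℂ (Fin 3 → ℂ)} (hx : ![1, 0, 0] ∈ Q) :
    TopClassified Q := by
  have key {Q : Submodule ℂ (Fin 3 → ℂ)} (hx : ![1, 0, 0] ∈ Q) (hy : ![0, 0, 1] ∈ Q) :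
      TopClassified Q := by
    by_cases hxy : ![0, 1, 0] ∈ Q
    · obtain rfl : Q = ⊤ := eq_top_iff.2 fun f _ => by
        rw [form_eq f]
        exact Q.add_mem (Q.add_mem (Q.smul_mem _ hx) (Q.smul_mem _ hxy)) (Q.smul_mem _ hy)
      exact .of_mem (by simp)
    · obtain rfl : Q = span ℂ {![1, 0, 0], ![0, 0, 1]} := by
        refine le_antisymm (fun f hf => mem_span_pair.2 ⟨f 0, f 2, ?_⟩) (span_le.2 ?_)
        · have h1 : f 1 • ![0, 1, 0] ∈ Q := by
            convert Q.sub_mem hf (Q.add_mem (Q.smul_mem (f 0) hx) (Q.smul_mem (f 2) hy)) using 1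
            ext i; fin_cases i <;> simp
          have h0 : f 1 = 0 := by
            by_contra h
            exact hxy ((Q.smul_mem_iff h).1 h1)
          ext i; fin_cases i <;> simp [h0]
        · rintro _ (rfl | rfl) <;> assumption
      exact .of_mem (by simp)
  by_cases hr : ∃ t ∈ Q, t 2 ≠ 0
  · obtain ⟨t, ht, hr⟩ := hr
    have hxx : ![1, 0, 0] ∈ Q.map (Chart.mk 1 0 0 (-t 1 / (2 * t 2)) 1 0 (by simp)).pullTop :=
      ⟨_, hx, by simp [Chart.pullTop_vec]⟩
    refine .of_map (.mk 1 0 0 (-t 1 / (2 * t 2)) 1 0 (by simp)) (key hxx ?_)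
    refine (Submodule.smul_mem_iff _ hr).1 ?_
    convert Submodule.sub_mem _ (Submodule.mem_map_of_mem ht)
      (Submodule.smul_mem _ (t 0 - t 1 ^ 2 / (4 * t 2)) hxx) using 1
    ext i; fin_cases i <;> simp [Chart.pullTop] <;> field_simp <;> ring
  · push Not at hr
    by_cases hxy : ![0, 1, 0] ∈ Q
    · obtain rfl : Q = span ℂ {![1, 0, 0], ![0, 1, 0]} := by
        refine le_antisymm (fun f hf => mem_span_pair.2 ⟨f 0, f 1, ?_⟩) (span_le.2 ?_)
        · ext i; fin_cases i <;> simp [hr f hf]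
        · rintro _ (rfl | rfl) <;> assumption
      exact .of_mem (by simp)
    · obtain rfl : Q = span ℂ {![1, 0, 0]} := by
        refine le_antisymm (fun f hf => mem_span_singleton.2 ⟨f 0, ?_⟩) (by simpa using hx)
        have h1 : f 1 • ![0, 1, 0] ∈ Q := by
          convert Q.sub_mem hf (Q.smul_mem (f 0) hx) using 1
          ext i; fin_cases i <;> simp [hr f hf]
        have h0 : f 1 = 0 := by
          by_contra h
          exact hxy ((Q.smul_mem_iff h).1 h1)
        ext i; fin_cases i <;> simp [h0, hr f hf]
      exact .of_mem (by simp)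

/-- A nonzero form of zero discriminant is a multiple of a square, and the base of the square can be
taken as the coordinate `x`. -/
theorem topClassified_of_discrim_eq_zero {Q : Submodule ℂ (Fin 3 → ℂ)} {p q r : ℂ}
    (hf : ![p, q, r] ∈ Q) (h0 : p ≠ 0 ∨ r ≠ 0) (hd : q ^ 2 = 4 * p * r) : TopClassified Q := by
  by_cases hp : p = 0
  · have hr : r ≠ 0 := by simpa [hp] using h0
    obtain rfl : q = 0 := by simpa [hp] using hd
    refine .of_map ⟨0, 1, 0, 1, 0, 0, by simp⟩ (topClassified_of_xx_mem
      ((Submodule.smul_mem_iff _ hr).1 ⟨_, hf, ?_⟩))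
    simp [Chart.pullTop_vec, hp]
  · refine .of_map ⟨1, -q / (2 * p), 0, 0, 1, 0, by simp⟩ (topClassified_of_xx_mem
      ((Submodule.smul_mem_iff _ hp).1 ⟨_, hf, ?_⟩))
    obtain rfl : r = q ^ 2 / (4 * p) := by rw [hd]; field_simp
    ext i; fin_cases i <;> simp [Chart.pullTop_vec] <;> field_simp <;> ring

theorem topClassified_of_xy_mem {Q : Submodule ℂ (Fin 3 → ℂ)} (hxy : ![0, 1, 0] ∈ Q) :
    TopClassified Q := by
  by_cases h : ∃ f ∈ Q, f 0 ≠ 0 ∨ f 2 ≠ 0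
  · obtain ⟨f, hf, h0⟩ := h
    -- Since `xy` is available, the middle coefficient of `f` is free and is chosen to make the
    -- discriminant zero.
    obtain ⟨l, hl⟩ := IsAlgClosed.exists_pow_nat_eq (4 * f 0 * f 2) two_pos
    refine topClassified_of_discrim_eq_zero (q := l) ?_ h0 hl
    convert Q.add_mem hf (Q.smul_mem (l - f 1) hxy) using 1
    ext i; fin_cases i <;> simp
  · push Not at h
    obtain rfl : Q = span ℂ {![0, 1, 0]} := by
      refine le_antisymm (fun f hf => mem_span_singleton.2 ⟨f 1, ?_⟩) (by simpa using hxy)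
      ext i; fin_cases i <;> simp [h f hf]
    exact .of_mem (by simp)

theorem topClassified (Q : Submodule ℂ (Fin 3 → ℂ)) : TopClassified Q := by
  rcases eq_or_ne Q ⊥ with rfl | hQ
  · exact .of_mem (by simp)
  have reduced {Q : Submodule ℂ (Fin 3 → ℂ)} {p q : ℂ} (hf : ![p, q, 0] ∈ Q)
      (h0 : p ≠ 0 ∨ q ≠ 0) : TopClassified Q := by
    by_cases hq : q = 0
    · exact topClassified_of_discrim_eq_zero hf (by simpa [hq] using h0) (by simp [hq])
    · refine .of_map ⟨1, 0, 0, -p / q, 1, 0, by simp⟩ (topClassified_of_xy_mem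
        ((Submodule.smul_mem_iff _ hq).1 ⟨_, hf, ?_⟩))
      ext i; fin_cases i <;> simp [Chart.pullTop_vec]
      field_simp
      ring
  obtain ⟨f, hf, hf0⟩ := Q.exists_mem_ne_zero_of_ne_bot hQ
  by_cases hp : f 0 = 0
  · refine .of_map ⟨0, 1, 0, 1, 0, 0, by simp⟩ (reduced (p := f 2) (q := f 1) ⟨_, hf, ?_⟩ ?_)
    · ext i; fin_cases i <;> simp [Chart.pullTop, hp]
    · by_contra! h
      refine hf0 ?_
      ext i; fin_cases i <;> simp [h, hp]
  -- A square root of the discriminant gives a linear factor of `f`. The shear moves the root to the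
  -- `y` direction, killing the `y²` coefficient and leaving `s` as the middle one.
  · obtain ⟨s, hs⟩ := IsAlgClosed.exists_pow_nat_eq (f 1 ^ 2 - 4 * f 0 * f 2) two_pos
    refine .of_map ⟨1, (s - f 1) / (2 * f 0), 0, 0, 1, 0, by simp⟩
      (reduced (p := f 0) (q := s) ⟨_, hf, ?_⟩ (.inl hp))
    ext i; fin_cases i <;> simp [Chart.pullTop] <;> field_simp <;>
      first | ring1 | linear_combination hs

end QuadOrbits

/-! ### Classification of all subspaces. -/

namespace QuadOrbits

open Set Submodule

/-- As `s` already accounts for all quadratic parts, `W` is the span of `s` plus the linear forms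
contained in `W`. The three cases are the dimensions 0, 1 and 2 of the latter space. -/
theorem eq_span_or_of_top_le {W : Submodule ℂ Cls} {s : Set Cls} (hs : s ⊆ W)
    (hW : W.map top ≤ span ℂ (top '' s)) : W = span ℂ s ∨
      (∃ l m : ℂ, (l ≠ 0 ∨ m ≠ 0) ∧ W = span ℂ (insert ![0, 0, 0, l, m] s)) ∨
      W = span ℂ (insert ![0, 0, 0, 1, 0] (insert ![0, 0, 0, 0, 1] s)) := by
  have key (f) (hf : f ∈ W) : ∃ p ∈ span ℂ s, ∃ l m, ![0, 0, 0, l, m] ∈ W ∧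
      f = ![0, 0, 0, l, m] + p := by
    have h := hW (Submodule.mem_map_of_mem hf)
    rw [← Submodule.map_span] at h
    obtain ⟨p, hp, he⟩ := h
    obtain ⟨l, m, hl⟩ := eq_vec_of_top_eq (f := f - p) (p := 0) (q := 0) (r := 0)
      (by rw [map_sub, he, sub_self]; ext i; fin_cases i <;> rfl)
    exact ⟨p, hp, l, m, hl ▸ W.sub_mem hf (span_le.2 hs hp), by rw [← hl]; simp⟩
  by_cases h₁ : ∀ l m, ![0, 0, 0, l, m] ∈ W → l = 0 ∧ m = 0
  · refine .inl (le_antisymm (fun f hf => ?_) (span_le.2 hs))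
    obtain ⟨p, hp, l, m, hl, rfl⟩ := key f hf
    obtain ⟨rfl, rfl⟩ := h₁ l m hl
    rwa [vec_zero, zero_add]
  push Not at h₁
  obtain ⟨l, m, hl, h0⟩ := h₁
  replace h0 : l ≠ 0 ∨ m ≠ 0 := by tauto
  by_cases h₂ : ∀ l' m', ![0, 0, 0, l', m'] ∈ W → l * m' - m * l' = 0
  · refine .inr (.inl ⟨l, m, h0, le_antisymm (fun f hf => ?_) (span_le.2 (insert_subset hl hs))⟩)
    obtain ⟨p, hp, l', m', hl', rfl⟩ := key f hf
    have h := h₂ l' m' hl'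
    refine add_mem ?_ (span_mono (subset_insert _ _) hp)
    have hmem : ![0, 0, 0, l, m] ∈ span ℂ (insert ![0, 0, 0, l, m] s) :=
      subset_span (mem_insert _ _)
    rcases h0 with h0 | h0
    · convert smul_mem _ (l' / l) hmem using 1
      ext i; fin_cases i <;> simp <;> field_simp
      linear_combination h
    · convert smul_mem _ (m' / m) hmem using 1
      ext i; fin_cases i <;> simp <;> field_simp
      linear_combination -h
  · push Not at h₂
    obtain ⟨l', m', hl', hd⟩ := h₂
    have hx : ![0, 0, 0, 1, 0] ∈ W := by
      refine (W.smul_mem_iff hd).1 ?_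
      convert W.sub_mem (W.smul_mem m' hl) (W.smul_mem m hl') using 1
      ext i; fin_cases i <;> simp <;> ring
    have hy : ![0, 0, 0, 0, 1] ∈ W := by
      refine (W.smul_mem_iff hd).1 ?_
      convert W.sub_mem (W.smul_mem l hl') (W.smul_mem l' hl) using 1
      ext i; fin_cases i <;> simp <;> ring
    refine .inr (.inr (le_antisymm (fun f hf => ?_)
      (span_le.2 (insert_subset hx (insert_subset hy hs)))))
    obtain ⟨p, hp, l'', m'', -, rfl⟩ := key f hf
    refine add_mem ?_ (span_mono ((subset_insert _ _).trans (subset_insert _ _)) hp)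
    convert add_mem (smul_mem _ l'' (subset_span (mem_insert ![0, 0, 0, 1, 0] _)))
      (smul_mem _ m'' (subset_span (mem_insert_of_mem _ (mem_insert ![0, 0, 0, 0, 1] s)))) using 1
    ext i; fin_cases i <;> simp

theorem range_triple {α : Type*} (u v w : α) : range ![u, v, w] = {w, u, v} := by
  ext x
  simp only [Matrix.range_cons, Matrix.range_empty, mem_union, mem_insert_iff, mem_singleton_iff]
  tauto

theorem range_quadruple {α : Type*} (u v w z : α) : range ![u, v, w, z] = {w, z, u, v} := by
  ext x
  simp only [Matrix.range_cons, Matrix.range_empty, mem_union, mem_insert_iff, mem_singleton_iff]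
  tauto

theorem classified_of_top_bot {W : Submodule ℂ Cls} (h : W.map top = ⊥) : Classified W := by
  rcases eq_span_or_of_top_le (s := ∅) (W := W) (by simp) (by simp [h]) with
    rfl | ⟨l, m, h0, rfl⟩ | rfl
  · convert classified_zero using 1
    simp only [Matrix.range_cons, Matrix.range_empty, span_union, vec_zero]
    simp
  · convert classified_linear l m h0 using 1
    simp only [Matrix.range_cons, Matrix.range_empty, span_insert, span_union, vec_zero]
    simp
  · convert classified_linear_linear using 1
    simp only [Matrix.range_cons, Matrix.range_empty, span_insert, span_union, vec_zero]
    simp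

theorem classified_of_top_xx {W : Submodule ℂ Cls} (h : W.map top = span ℂ {![1, 0, 0]}) :
    Classified W := by
  obtain ⟨v, hv, he⟩ : ![1, 0, 0] ∈ W.map top := h ▸ subset_span rfl
  obtain ⟨α, β, rfl⟩ := eq_vec_of_top_eq he
  rcases eq_span_or_of_top_le (s := {![1, 0, 0, α, β]}) (W := W) (by simpa)
    (by simp [h, top_vec]) with rfl | ⟨l, m, h0, rfl⟩ | rfl
  · convert classified_xx α β using 1
    simp only [Matrix.range_cons, Matrix.range_empty, span_union, vec_zero]
    simp
  · convert classified_xx_linear α β l m h0 using 1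
    simp only [Matrix.range_cons, Matrix.range_empty, span_insert, span_union, vec_zero]
    simp [sup_comm]
  · convert classified_xx_linear_linear α β using 1
    simp only [Matrix.range_cons, Matrix.range_empty, span_insert, span_union, span_empty,
      sup_bot_eq]
    ac_rfl

theorem classified_of_top_xy {W : Submodule ℂ Cls} (h : W.map top = span ℂ {![0, 1, 0]}) :
    Classified W := by
  obtain ⟨v, hv, he⟩ : ![0, 1, 0] ∈ W.map top := h ▸ subset_span rfl
  obtain ⟨α, β, rfl⟩ := eq_vec_of_top_eq he
  rcases eq_span_or_of_top_le (s := {![0, 1, 0, α, β]}) (W := W) (by simpa)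
    (by simp [h, top_vec]) with rfl | ⟨l, m, h0, rfl⟩ | rfl
  · convert classified_xy α β using 1
    simp only [Matrix.range_cons, Matrix.range_empty, span_union, vec_zero]
    simp
  · convert classified_xy_linear α β l m h0 using 1
    simp only [Matrix.range_cons, Matrix.range_empty, span_insert, span_union, vec_zero]
    simp [sup_comm]
  · convert classified_xy_linear_linear α β using 1
    simp only [Matrix.range_cons, Matrix.range_empty, span_insert, span_union, span_empty,
      sup_bot_eq]
    ac_rfl

theorem classified_of_top_xx_xy {W : Submodule ℂ Cls}
    (h : W.map top = span ℂ {![1, 0, 0], ![0, 1, 0]}) : Classified W := by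
  obtain ⟨v, hv, he⟩ : ![1, 0, 0] ∈ W.map top := h ▸ subset_span (by simp)
  obtain ⟨α, β, rfl⟩ := eq_vec_of_top_eq he
  obtain ⟨w, hw, he'⟩ : ![0, 1, 0] ∈ W.map top := h ▸ subset_span (by simp)
  obtain ⟨γ, δ, rfl⟩ := eq_vec_of_top_eq he'
  rcases eq_span_or_of_top_le (s := {![1, 0, 0, α, β], ![0, 1, 0, γ, δ]}) (W := W)
    (insert_subset hv (by simpa)) (by simp [h, top_vec, image_insert_eq]) with
    rfl | ⟨l, m, h0, rfl⟩ | rfl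
  · convert classified_xx_xy α β γ δ using 1
    simp only [Matrix.range_cons, Matrix.range_empty, span_insert, span_union, vec_zero]
    simp
  · convert classified_xx_xy_linear α β γ δ l m h0 using 1
    rw [range_triple]
  · convert classified_xx_xy_top α β γ δ using 1
    rw [range_quadruple]

theorem classified_of_top_xx_yy {W : Submodule ℂ Cls}
    (h : W.map top = span ℂ {![1, 0, 0], ![0, 0, 1]}) : Classified W := by
  obtain ⟨v, hv, he⟩ : ![1, 0, 0] ∈ W.map top := h ▸ subset_span (by simp)
  obtain ⟨α, β, rfl⟩ := eq_vec_of_top_eq he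
  obtain ⟨w, hw, he'⟩ : ![0, 0, 1] ∈ W.map top := h ▸ subset_span (by simp)
  obtain ⟨γ, δ, rfl⟩ := eq_vec_of_top_eq he'
  rcases eq_span_or_of_top_le (s := {![1, 0, 0, α, β], ![0, 0, 1, γ, δ]}) (W := W)
    (insert_subset hv (by simpa)) (by simp [h, top_vec, image_insert_eq]) with
    rfl | ⟨l, m, h0, rfl⟩ | rfl
  · convert classified_xx_yy α β γ δ using 1
    simp only [Matrix.range_cons, Matrix.range_empty, span_insert, span_union, vec_zero]
    simp
  · convert classified_xx_yy_linear α β γ δ l m h0 using 1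
    rw [range_triple]
  · convert classified_xx_yy_top α β γ δ using 1
    rw [range_quadruple]

theorem exists_mem_of_map_top_eq_top {W : Submodule ℂ Cls} (h : W.map top = ⊤) (p q r : ℂ) :
    ∃ u v, ![p, q, r, u, v] ∈ W := by
  obtain ⟨f, hf, he⟩ : ![p, q, r] ∈ W.map top := h ▸ mem_top
  obtain ⟨u, v, rfl⟩ := eq_vec_of_top_eq he
  exact ⟨u, v, hf⟩

/-- Modulo `x` and lifts of the three monomials only a multiple of `y` is left. So `W` is either
everything or spanned by these four elements. -/
theorem classified_of_x_mem {W : Submodule ℂ Cls} (h : W.map top = ⊤)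
    (hx : ![0, 0, 0, 1, 0] ∈ W) : Classified W := by
  obtain ⟨α, β, h₀⟩ := exists_mem_of_map_top_eq_top h 1 0 0
  obtain ⟨γ, δ, h₁⟩ := exists_mem_of_map_top_eq_top h 0 1 0
  obtain ⟨ε, ζ, h₂⟩ := exists_mem_of_map_top_eq_top h 0 0 1
  have hf (f : Cls) : f = f 0 • ![1, 0, 0, α, β] + f 2 • ![0, 0, 1, ε, ζ]
      + f 1 • ![0, 1, 0, γ, δ]
      + (f 3 - f 0 * α - f 1 * γ - f 2 * ε) • ![0, 0, 0, 1, 0]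
      + (f 4 - f 0 * β - f 1 * δ - f 2 * ζ) • ![0, 0, 0, 0, 1] := by
    ext i; fin_cases i <;> simp <;> ring
  have hmem (f : Cls) : f 0 • ![1, 0, 0, α, β] + f 2 • ![0, 0, 1, ε, ζ]
      + f 1 • ![0, 1, 0, γ, δ]
      + (f 3 - f 0 * α - f 1 * γ - f 2 * ε) • ![0, 0, 0, 1, 0] ∈ W :=
    W.add_mem (W.add_mem (W.add_mem (W.smul_mem _ h₀) (W.smul_mem _ h₂)) (W.smul_mem _ h₁))
      (W.smul_mem _ hx)
  by_cases hy : ![0, 0, 0, 0, 1] ∈ W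
  · obtain rfl : W = ⊤ := eq_top_iff.2 fun f _ => by
      rw [hf f]
      exact W.add_mem (hmem f) (W.smul_mem _ hy)
    exact classified_top
  · convert classified_full_x α β γ δ ε ζ using 1
    refine le_antisymm (fun f hW => ?_) (span_le.2 ?_)
    · have h0 : f 4 - f 0 * β - f 1 * δ - f 2 * ζ = 0 := by
        by_contra h
        refine hy ((W.smul_mem_iff h).1 ?_)
        convert W.sub_mem hW (hmem f) using 1
        rw [eq_sub_iff_add_eq, add_comm, ← hf]
      rw [hf f, h0]
      refine (mem_span_range_iff_exists_fun ℂ).2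
        ⟨![f 0, f 2, f 1, f 3 - f 0 * α - f 1 * γ - f 2 * ε], ?_⟩
      simp [Fin.sum_univ_succ]
      constructor <;> ring
    · rintro _ ⟨i, rfl⟩
      fin_cases i <;> assumption

theorem classified_of_square_mem {W : Submodule ℂ Cls} (h : W.map top = ⊤)
    (h0 : ∀ l m, ![0, 0, 0, l, m] ∈ W → l = 0 ∧ m = 0) {α : ℂ} (h₀ : ![1, 0, 0, α, 0] ∈ W) :
    Classified W := by
  obtain ⟨γ, δ, h₁⟩ := exists_mem_of_map_top_eq_top h 0 1 0
  obtain ⟨ε, ζ, h₂⟩ := exists_mem_of_map_top_eq_top h 0 0 1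
  convert classified_full α γ δ ε ζ using 1
  refine le_antisymm (fun f hW => ?_) (span_le.2 ?_)
  · obtain ⟨h3, h4⟩ := h0 (f 3 - f 0 * α - f 1 * γ - f 2 * ε) (f 4 - f 1 * δ - f 2 * ζ) (by
      convert W.sub_mem hW (W.add_mem (W.add_mem (W.smul_mem (f 0) h₀) (W.smul_mem (f 1) h₁))
        (W.smul_mem (f 2) h₂)) using 1
      ext i; fin_cases i <;> simp <;> ring)
    refine (mem_span_range_iff_exists_fun ℂ).2 ⟨![f 0, f 1, f 2], ?_⟩
    ext i; fin_cases i <;> simp [Fin.sum_univ_succ]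
    · linear_combination -h3
    · linear_combination -h4
  · rintro _ ⟨i, rfl⟩
    fin_cases i <;> assumption

theorem exists_root_binary_cubic (a b c d : ℂ) : ∃ s t : ℂ, (s ≠ 0 ∨ t ≠ 0) ∧
    a * s ^ 3 + b * s ^ 2 * t + c * s * t ^ 2 + d * t ^ 3 = 0 := by
  by_cases ha : a = 0
  · exact ⟨1, 0, by simp, by simp [ha]⟩
  · obtain ⟨s, hs⟩ := IsAlgClosed.exists_root (Cubic.toPoly ⟨a, b, c, d⟩)
      (by rw [Cubic.degree_of_a_ne_zero ha]; decide)
    refine ⟨s, 1, by simp, ?_⟩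
    simp only [Cubic.toPoly, Polynomial.IsRoot, Polynomial.eval_add, Polynomial.eval_mul,
      Polynomial.eval_C, Polynomial.eval_pow, Polynomial.eval_X] at hs
    linear_combination hs

/-- Lifting the quadratic monomials gives a linear map `λ` from quadratic to linear forms whose
graph lies in `W`. For `ℓ = sx + ty`, proportionality of `λ(ℓ²)` to `ℓ` is a cubic equation in `(s,
t)`, which has a nontrivial root. -/
theorem exists_square_add_mem {W : Submodule ℂ Cls} (h : W.map top = ⊤) : ∃ s t ρ : ℂ,
    (s ≠ 0 ∨ t ≠ 0) ∧ ![s ^ 2, 2 * s * t, t ^ 2, ρ * s, ρ * t] ∈ W := by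
  obtain ⟨α, β, h₀⟩ := exists_mem_of_map_top_eq_top h 1 0 0
  obtain ⟨γ, δ, h₁⟩ := exists_mem_of_map_top_eq_top h 0 1 0
  obtain ⟨ε, ζ, h₂⟩ := exists_mem_of_map_top_eq_top h 0 0 1
  -- The cubic is `t` times the `x` coefficient of `λ(ℓ²)` minus `s` times its `y` coefficient.
  obtain ⟨s, t, h0, hst⟩ := exists_root_binary_cubic (-β) (α - 2 * δ) (2 * γ - ζ) ε
  have hmem := W.add_mem (W.add_mem (W.smul_mem (s ^ 2) h₀) (W.smul_mem (2 * s * t) h₁))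
    (W.smul_mem (t ^ 2) h₂)
  rcases eq_or_ne s 0 with hs | hs
  · have ht : t ≠ 0 := by simpa [hs] using h0
    refine ⟨s, t, (s ^ 2 * β + 2 * s * t * δ + t ^ 2 * ζ) / t, h0, ?_⟩
    convert hmem using 1
    ext i; fin_cases i <;> simp <;> field_simp
    linear_combination -hst
  · refine ⟨s, t, (s ^ 2 * α + 2 * s * t * γ + t ^ 2 * ε) / s, h0, ?_⟩
    convert hmem using 1
    ext i; fin_cases i <;> simp <;> field_simp
    linear_combination hst

/-- If `W` has no linear form, the `ℓ` of an element `ℓ² + ρℓ` is made the new coordinate `x`;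
otherwise a linear form of `W` is. In the first case the absence of linear forms survives the
substitution. -/
theorem classified_of_top_top {W : Submodule ℂ Cls} (h : W.map top = ⊤) : Classified W := by
  by_cases h0 : ∀ l m, ![0, 0, 0, l, m] ∈ W → l = 0 ∧ m = 0
  · obtain ⟨s, t, ρ, hst, hmem⟩ := exists_square_add_mem h
    obtain ⟨d, e, hd⟩ := Chart.exists_row hst
    let R : Chart := ⟨s, t, 0, d, e, 0, hd⟩
    refine .of_map R.inv (classified_of_square_mem (α := ρ)
      (by rw [R.inv.map_top_map_pull, h, Chart.map_pullTop_top]) ?_ ⟨_, hmem, ?_⟩)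
    · rintro l m ⟨f, hf, he⟩
      obtain rfl : f = R.pull ![0, 0, 0, l, m] := by rw [← he, R.pull_inv_pull]
      rw [Chart.pull_vec] at hf
      obtain ⟨h1, h2⟩ := h0 (l * s + m * d) (l * t + m * e) (by simpa [R] using hf)
      constructor <;> refine (mul_eq_zero.1 ?_).resolve_right hd
      · linear_combination e * h1 - d * h2
      · linear_combination s * h2 - t * h1
    · rw [← R.inv_pull_pull ![1, 0, 0, ρ, 0], R.pull_vec]
      simp [R, mul_assoc]
  · push Not at h0
    obtain ⟨l, m, hl, h0⟩ := h0
    obtain ⟨d, e, hd⟩ := Chart.exists_row (p := l) (q := m) (by tauto)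
    let R : Chart := ⟨l, m, 0, d, e, 0, hd⟩
    refine .of_map R.inv (classified_of_x_mem
      (by rw [R.inv.map_top_map_pull, h, Chart.map_pullTop_top]) ⟨_, hl, ?_⟩)
    rw [← R.inv_pull_pull ![0, 0, 0, 1, 0], R.pull_vec]
    simp [R]

theorem classified (W : Submodule ℂ Cls) : Classified W := by
  obtain ⟨R, hR⟩ := topClassified (W.map top)
  rw [← R.map_top_map_pull] at hR
  refine .of_map R ?_
  rcases hR with h | h | h | h | h | h
  exacts [classified_of_top_bot h, classified_of_top_xx h, classified_of_top_xy h,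
    classified_of_top_xx_xy h, classified_of_top_xx_yy h, classified_of_top_top h]

end QuadOrbits

theorem mainTheorem12 (n : ℕ) (hn : 3 ≤ n) :
    -- the orbits of the diagram are all the orbits, each of them occurring once
    (∀ F : QuadOrbits.QuadMap n,
      ∃! a : QuadOrbits.Label, a.dim ≤ n ∧ F ∈ QuadOrbits.Label.orbit n a) ∧
    -- containment in closures is given by the rising paths of the diagram
    (∀ a b : QuadOrbits.Label, a.dim ≤ n → b.dim ≤ n →
      (QuadOrbits.Label.orbit n a ⊆ closure (QuadOrbits.Label.orbit n b) ↔
        QuadOrbits.RisingPath a b)) ∧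
    -- in particular
    (4 ≤ n → QuadOrbits.Label.orbit n .G3 ⊆ closure (QuadOrbits.Label.orbit n .G2)) ∧
    ¬ QuadOrbits.Label.orbit n .F11 ⊆ closure (QuadOrbits.Label.orbit n .F3) ∧
    ¬ QuadOrbits.Label.orbit n .F17 ⊆ closure (QuadOrbits.Label.orbit n .F11) ∧
    ¬ QuadOrbits.Label.orbit n .F20 ⊆ closure (QuadOrbits.Label.orbit n .F4) := by
  refine ⟨fun F => ?_, fun a b ha hb =>
    (QuadOrbits.orbit_subset_closure_iff ha hb).trans QuadOrbits.degen_gens_iff, fun h4 => ?_,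
    ?_, ?_, ?_⟩
  · obtain ⟨a, R, h⟩ := QuadOrbits.classified (Submodule.span ℂ (Set.range (QuadOrbits.clsMap n F)))
    have ha := QuadOrbits.dim_le_of_span_eq hn h
    have hF := (QuadOrbits.mem_orbit_iff_span ha F).2 ⟨R, h⟩
    refine ⟨a, ⟨ha, hF⟩, fun b ⟨hb, hF'⟩ => ?_⟩
    -- A mapping in two orbits makes each normal form a degeneration of the other, and the diagram
    -- is acyclic.
    exact QuadOrbits.RisingPath.antisymm
      (QuadOrbits.degen_gens_iff.1 (QuadOrbits.degen_of_mem_orbit hb ha hF' hF))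
      (QuadOrbits.degen_gens_iff.1 (QuadOrbits.degen_of_mem_orbit ha hb hF hF'))
  · exact (QuadOrbits.orbit_subset_closure_iff h4 h4).2 QuadOrbits.degen_G3_G2
  · rw [QuadOrbits.orbit_subset_closure_iff hn hn]
    exact QuadOrbits.not_degen_F11_F3
  · rw [QuadOrbits.orbit_subset_closure_iff hn hn]
    exact QuadOrbits.not_degen_F17_F11
  · rw [QuadOrbits.orbit_subset_closure_iff hn hn]
    exact QuadOrbits.not_degen_F20_F4
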